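/- **Setting.** Let $A\in\mathbb R^{n\times n}$, $B\in\mathbb R^{n\times l}$ with $(A,B)$ stabilizable, $E\in\mathbb R^{n\times m}$, $z\in\mathbb R^n$; let $Q_1,Q_2,R_2$ be symmetric positive semidefinite, $R_1$ symmetric positive definite, $s\in\mathbb R^n$, $v\in\mathbb R^l$, $c\in\mathbb R$. On a probability space $(\Omega,\mathcal F,\mathbb P)$ let $W(0),W(1),\dots$ be i.i.d. random vectors in $L^2(\Omega;\mathbb R^m)$ with mean $\mu_W$. Put $f(x,u,w)=Ax+Bu+Ew+z$ and, for $X,U$ in $L^2$, $$\ell(X,U)=\mathbb E\big[X^TQ_1X+U^TR_1U+s^TX+v^TU+c\big]+\operatorname{tr}\big(Q_2\operatorname{Cov}(X)+R_2\operatorname{Cov}(U)\big).$$ For $X_0\in L^2$ and a control process $U$, $X_U(\cdot)$ is the solution of $X(k+1)=f(X(k),U(k),W(k))$, $X(0)=X_0$, and $J_N(X_0,U)=\sum_{k=0}^{N-1}\ell(X_U(k),U(k))$. A control process on $\{0,\dots,N-1\}$ is admissible if, for each $k<N$, $U(k)$ is in $L^2$ and $\sigma(X_U(0),\dots,X_U(k))$-measurable,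 and $W(k)$ is independent of $X_U(k)$ and of $U(k)$. $\mathcal K_\infty$ is the class of continuous, strictly increasing, unbounded $\alpha:[0,\infty)\to[0,\infty)$ with $\alpha(0)=0$. A pair of processes $(X^s,U^s)$ is stationary if all $X^s(k)$ have the same law, all $U^s(k)$ have the same law, both laws have finite second moment, $W(k)$ is independent of $X^s(k)$ and of $U^s(k)$, and $X^s(k+1)=f(X^s(k),U^s(k),W(k))$ for all $k$. The problem is strictly dissipative in $L^2$ at $(X^s,U^s)$ with storage function $\lambda$ and comparison function $\alpha\in\mathcal K_\infty$ if $\lambda(k,X)\in\mathbb R$ is bounded from below uniformly in $k\in\mathbb N_0$ and $X\in L^2$, and $$\ell(X,U)-\ell(X^s(k),U^s(k))+\lambda(k,X)-\lambda(k+1,f(X,U,W(k)))\ \ge\ \alpha\big(\mathbb E\|X-X^s(k)\|^2\big)$$ for all $k$ and all $X,U$ in $L^2$ such that $W(k)$ is independent of $X$ and of $U$. **Theorem.** Assume that $(I-A)x^s-Bu^s=E\mu_W+z$ for some $(x^s,u^s)$ and that $(A,Q_1^{1/2})$ is detectable. Then there exist a positive semidefinite solution $P$ of $$P=A^TPA+(Q_1+Q_2)-A^TPB\,[(R_1+R_2)+B^TPB]^{-1}B^TPA,$$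 a symmetric positive definite $S$, $q\in\mathbb R^n$, a pair $(\tilde x,\tilde u)$ with $(I-A)\tilde x-B\tilde u=0$, a function $\alpha\in\mathcal K_\infty$, and a probability measure $\varrho$ on $\mathbb R^n$ with finite second moment, such that, with $K=-[(R_1+R_2)+B^TPB]^{-1}B^TPA$ and $\pi(x)=K(x-\tilde x-x^s)+\tilde u+u^s$, the following holds. The measure $\varrho$ is invariant for $X^+=f(X,\pi(X),W)$, $W\sim W(0)$ independent of $X$; and if $\Omega$ carries a uniformly distributed random variable independent of $(W(k))_k$, then there is a random vector with law $\varrho$ independent of $(W(k))_k$. For every $X^s_\star(0)\sim\varrho$ independent of $(W(k))_k$, the processes $X^s_\star(k+1)=f(X^s_\star(k),U^s_\star(k),W(k))$, $U^s_\star(k)=\pi(X^s_\star(k))$ satisfy: 1. $(X^s_\star,U^s_\star)$ is stationary, and the problem is strictly dissipative in $L^2$ at $(X^s_\star,U^s_\star)$ with comparison function $\alpha$ and storage function $\lambda(k,X)=\mathbb E\big[\|X-(X^s_\star(k)-\tilde x)\|^2_{P+S}-\|X-x^s\|_P^2+q^T(X-(X^s_\star(k)-\tilde x))\big]$, where $\|x\|_M^2=x^TMx$.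 2. For every $X_0\in L^2$ there is $C\in\mathbb R$ such that for all $N\in\mathbb N_0$, all $\delta>0$, all admissible $U$ with $J_N(X_0,U)\le\delta+\sum_{k=0}^{N-1}\ell(X^s_\star(k),U^s_\star(k))$ and all $\varepsilon>0$, the numbers $$\mathcal M^1_\varepsilon=\#\{k<N:\ \|\mathbb E X_U(k)-\mathbb E X^s_\star(k)\|\le\varepsilon\},$$ $$\mathcal M^2_\varepsilon=\#\Big\{k<N:\ \Big|\sqrt{\operatorname{tr}\operatorname{Cov}X_U(k)}-\sqrt{\operatorname{tr}\operatorname{Cov}X^s_\star(k)}\Big|\le\varepsilon\Big\}$$ satisfy $\mathcal M^1_\varepsilon\ge N-(\delta+C)/\alpha(\sqrt{\varepsilon})$ and $\mathcal M^2_\varepsilon\ge N-(\delta+C)/\alpha(\sqrt{2\varepsilon})$. 3. If the problem is strictly dissipative in $L^2$ at $(X^s_\star,U^s_\star)$ with an arbitrary storage function and comparison function $\beta\in\mathcal K_\infty$, then the assertion of item 2 holds (with a constant $C$ that may depend on these) with the bounds $\mathcal M^1_\varepsilon\ge N-(\delta+C)/\beta(\varepsilon^2)$ and $\mathcal M^2_\varepsilon\ge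 N-(\delta+C)/\beta(\varepsilon^2)$. -/

import Mathlib

open MeasureTheory ProbabilityTheory
open scoped Matrix MatrixOrder

namespace StochLQ

/-- `ℝᵈ` with the Euclidean norm. -/
abbrev Vec (d : ℕ) : Type := EuclideanSpace ℝ (Fin d)

/-- The matrix-vector product `M x`. -/
noncomputable def mv {a b : ℕ} (M : Matrix (Fin a) (Fin b) ℝ) (x : Vec b) : Vec a :=
  Matrix.toEuclideanLin M x

/-- The quadratic form `xᵀ M x`, written `‖x‖²_M`. -/
noncomputable def qf {d : ℕ} (M : Matrix (Fin d) (Fin d) ℝ) (x : Vec d) : ℝ :=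
  inner ℝ x (mv M x)

/-- All complex eigenvalues lie in the open unit disc. -/
def IsSchurStable {d : ℕ} (M : Matrix (Fin d) (Fin d) ℝ) : Prop :=
  ∀ μ ∈ spectrum ℂ (M.map (algebraMap ℝ ℂ)), ‖μ‖ < 1

def IsStabilizable {n l : ℕ} (A : Matrix (Fin n) (Fin n) ℝ) (B : Matrix (Fin n) (Fin l) ℝ) :
    Prop :=
  ∃ F : Matrix (Fin l) (Fin n) ℝ, IsSchurStable (A + B * F)

def IsDetectable {n p : ℕ} (A : Matrix (Fin n) (Fin n) ℝ) (C : Matrix (Fin p) (Fin n) ℝ) :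
    Prop :=
  ∃ L : Matrix (Fin n) (Fin p) ℝ, IsSchurStable (A + L * C)

/-- Class `𝒦_∞`; only the values of `α` on `[0, ∞)` matter. -/
structure IsClassKInfty (α : ℝ → ℝ) : Prop where
  continuousOn : ContinuousOn α (Set.Ici 0)
  strictMonoOn : StrictMonoOn α (Set.Ici 0)
  map_zero : α 0 = 0
  unbounded : ∀ b : ℝ, ∃ t : ℝ, 0 ≤ t ∧ b ≤ α t

/-- The coefficients of the dynamics `X⁺ = A X + B U + E W + z` and of the stage cost. -/
structure Data (n l m : ℕ) where
  A : Matrix (Fin n) (Fin n) ℝ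
  B : Matrix (Fin n) (Fin l) ℝ
  E : Matrix (Fin n) (Fin m) ℝ
  z : Vec n
  Q₁ : Matrix (Fin n) (Fin n) ℝ
  Q₂ : Matrix (Fin n) (Fin n) ℝ
  R₁ : Matrix (Fin l) (Fin l) ℝ
  R₂ : Matrix (Fin l) (Fin l) ℝ
  s : Vec n
  v : Vec l
  c : ℝ

variable {n l m : ℕ} {Ω : Type*} [MeasurableSpace Ω]

/-- The dynamics `f(x, u, w) = A x + B u + E w + z`. -/
noncomputable def Data.f (D : Data n l m) (x : Vec n) (u : Vec l) (w : Vec m) : Vec n :=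
  mv D.A x + mv D.B u + mv D.E w + D.z

/-- The covariance matrix of a random vector. -/
noncomputable def covMat {d : ℕ} (Pr : Measure Ω) (X : Ω → Vec d) : Matrix (Fin d) (Fin d) ℝ :=
  Matrix.of fun i j => cov[fun ω => X ω i, fun ω => X ω j; Pr]

/-- The stage cost `ℓ(X, U)`. -/
noncomputable def Data.cost (D : Data n l m) (Pr : Measure Ω) (X : Ω → Vec n) (U : Ω → Vec l) : ℝ :=
  (∫ ω, (qf D.Q₁ (X ω) + qf D.R₁ (U ω) + inner ℝ D.s (X ω) + inner ℝ D.v (U ω) + D.c) ∂Pr)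
    + (D.Q₂ * covMat Pr X).trace + (D.R₂ * covMat Pr U).trace

/-- The solution `X_U(·, X₀)`. -/
noncomputable def Data.traj (D : Data n l m) (W : ℕ → Ω → Vec m) (X₀ : Ω → Vec n)
    (U : ℕ → Ω → Vec l) : ℕ → Ω → Vec n
  | 0 => X₀
  | k + 1 => fun ω => D.f (D.traj W X₀ U k ω) (U k ω) (W k ω)

/-- The total cost `J_N(X₀, U)`. -/
noncomputable def Data.totalCost (D : Data n l m) (Pr : Measure Ω) (W : ℕ → Ω → Vec m)
    (X₀ : Ω → Vec n) (N : ℕ) (U : ℕ → Ω → Vec l) : ℝ :=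
  ∑ k ∈ Finset.range N, D.cost Pr (D.traj W X₀ U k) (U k)

/-- The `σ`-algebra `σ(X(0), …, X(k))`. -/
abbrev history (X : ℕ → Ω → Vec n) (k : ℕ) : MeasurableSpace Ω :=
  ⨆ (j : ℕ) (_ : j ≤ k), MeasurableSpace.comap (X j) inferInstance

/-- Control processes of the problem on `{0, …, N-1}`: square integrable, adapted to the filtration
generated by the state, with `W(k)` independent of `X(k)` and of `U(k)`. -/
structure Data.IsAdmissible (D : Data n l m) (Pr : Measure Ω) (W : ℕ → Ω → Vec m)
    (X₀ : Ω → Vec n) (N : ℕ) (U : ℕ → Ω → Vec l) : Prop where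
  memLp : ∀ k < N, MemLp (U k) 2 Pr
  adapted : ∀ k < N, Measurable[history (D.traj W X₀ U) k] (U k)
  indep_state : ∀ k < N, IndepFun (D.traj W X₀ U k) (W k) Pr
  indep_control : ∀ k < N, IndepFun (U k) (W k) Pr

/-- Stationary pairs of state and control processes. -/
structure Data.IsStationaryPair (D : Data n l m) (Pr : Measure Ω) (W : ℕ → Ω → Vec m)
    (Xs : ℕ → Ω → Vec n) (Us : ℕ → Ω → Vec l) : Prop where
  law_state : ∃ ρ : Measure (Vec n), IsProbabilityMeasure ρ ∧ MemLp id 2 ρ ∧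
    ∀ k, HasLaw (Xs k) ρ Pr
  law_control : ∃ ρ : Measure (Vec l), IsProbabilityMeasure ρ ∧ MemLp id 2 ρ ∧
    ∀ k, HasLaw (Us k) ρ Pr
  dynamics : ∀ k, Xs (k + 1) =ᵐ[Pr] fun ω => D.f (Xs k ω) (Us k ω) (W k ω)
  indep_state : ∀ k, IndepFun (Xs k) (W k) Pr
  indep_control : ∀ k, IndepFun (Us k) (W k) Pr

/-- Strict dissipativity in `L²` at `(Xs, Us)` with storage function `lam` and comparison
function `α`. -/
structure Data.IsStrictlyDissipative (D : Data n l m) (Pr : Measure Ω) (W : ℕ → Ω → Vec m)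
    (Xs : ℕ → Ω → Vec n) (Us : ℕ → Ω → Vec l) (lam : ℕ → (Ω → Vec n) → ℝ) (α : ℝ → ℝ) : Prop where
  bddBelow : ∃ M : ℝ, ∀ k X, MemLp X 2 Pr → M ≤ lam k X
  kInfty : IsClassKInfty α
  ineq : ∀ k X U, MemLp X 2 Pr → MemLp U 2 Pr → IndepFun X (W k) Pr → IndepFun U (W k) Pr →
    α (∫ ω, ‖X ω - Xs k ω‖ ^ 2 ∂Pr) ≤
      D.cost Pr X U - D.cost Pr (Xs k) (Us k)
        + lam k X - lam (k + 1) (fun ω => D.f (X ω) (U ω) (W k ω))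

/-- `P` is a positive semidefinite solution of the algebraic Riccati equation with weights
`Q₁ + Q₂` and `R₁ + R₂`. -/
def Data.IsRiccatiSolution (D : Data n l m) (P : Matrix (Fin n) (Fin n) ℝ) : Prop :=
  P.PosSemidef ∧
    P = D.Aᵀ * P * D.A + (D.Q₁ + D.Q₂)
      - D.Aᵀ * P * D.B * ((D.R₁ + D.R₂) + D.Bᵀ * P * D.B)⁻¹ * D.Bᵀ * P * D.A

/-- The gain `K = -[(R₁ + R₂) + Bᵀ P B]⁻¹ Bᵀ P A`. -/
noncomputable def Data.gain (D : Data n l m) (P : Matrix (Fin n) (Fin n) ℝ) :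
    Matrix (Fin l) (Fin n) ℝ :=
  -(((D.R₁ + D.R₂) + D.Bᵀ * P * D.B)⁻¹ * D.Bᵀ * P * D.A)

/-- The affine feedback `x ↦ K (x - xt - xs) + ut + us`. -/
noncomputable def Data.feedback (D : Data n l m) (P : Matrix (Fin n) (Fin n) ℝ)
    (xs xt : Vec n) (us ut : Vec l) (x : Vec n) : Vec l :=
  mv (D.gain P) (x - xt - xs) + ut + us

/-- The storage function
`λ(k, X) = E[‖X - (Xs(k) - xt)‖²_{P+S} - ‖X - xs‖²_P + qᵀ (X - (Xs(k) - xt))]`. -/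
noncomputable def storage (Pr : Measure Ω) (P S : Matrix (Fin n) (Fin n) ℝ) (q xs xt : Vec n)
    (Xs : ℕ → Ω → Vec n) (k : ℕ) (X : Ω → Vec n) : ℝ :=
  ∫ ω, (qf (P + S) (X ω - (Xs k ω - xt)) - qf P (X ω - xs)
    + inner ℝ q (X ω - (Xs k ω - xt))) ∂Pr

/-- The number of times `k < N` with `‖E X(k) - E Xs(k)‖ ≤ ε`. -/
noncomputable def meanCount (Pr : Measure Ω) (X Xs : ℕ → Ω → Vec n) (N : ℕ) (ε : ℝ) : ℕ :=
  Set.ncard {k : ℕ | k < N ∧ ‖(∫ ω, X k ω ∂Pr) - ∫ ω, Xs k ω ∂Pr‖ ≤ ε}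

/-- The number of times `k < N` with `|√(tr Cov X(k)) - √(tr Cov Xs(k))| ≤ ε`. -/
noncomputable def varCount (Pr : Measure Ω) (X Xs : ℕ → Ω → Vec n) (N : ℕ) (ε : ℝ) : ℕ :=
  Set.ncard {k : ℕ | k < N ∧
    |√((covMat Pr (X k)).trace) - √((covMat Pr (Xs k)).trace)| ≤ ε}

/-- The turnpike property of the first two moments at `(Xs, Us)`, with rates `a₁(ε)` for the
expectation and `a₂(ε)` for the square root of the trace of the covariance. -/
def Data.MomentTurnpike (D : Data n l m) (Pr : Measure Ω) (W : ℕ → Ω → Vec m)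
    (Xs : ℕ → Ω → Vec n) (Us : ℕ → Ω → Vec l) (a₁ a₂ : ℝ → ℝ) : Prop :=
  ∀ X₀ : Ω → Vec n, Measurable X₀ → MemLp X₀ 2 Pr →
    ∃ C : ℝ, ∀ (N : ℕ) (δ : ℝ), 0 < δ → ∀ U : ℕ → Ω → Vec l, D.IsAdmissible Pr W X₀ N U →
      D.totalCost Pr W X₀ N U ≤ δ + ∑ k ∈ Finset.range N, D.cost Pr (Xs k) (Us k) →
      ∀ ε : ℝ, 0 < ε →
        (N : ℝ) - (δ + C) / a₁ ε ≤ meanCount Pr (D.traj W X₀ U) Xs N ε ∧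
        (N : ℝ) - (δ + C) / a₂ ε ≤ varCount Pr (D.traj W X₀ U) Xs N ε

end StochLQ

open StochLQ

/-!
Detectability of `(A, √Q₁)` yields a matrix `S` making `xᵀ S x` a strict storage function of the
deterministic system, with supply rate given by `Q₁` and `R₁`. Together with stabilizability this
gives a Riccati solution `P` with exponentially stable closed loop `A + B K`, so the affine
feedback has a square-integrable invariant law.

Choose the feedback to fix a steady state minimizing the deterministic part of the cost. Compared
with the resulting stationary process `(Y, V)`, the cost of `(X, U)` then exceeds that of `(Y, V)`
by quadratic terms in `X - Y` and `U - V`, controlled by `S`, plus linear terms, which telescope: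
those in the means through the multiplier `q` of the steady-state constraint, those in the centred
parts through `P`. Hence dissipativity at rate `c E ‖X - Y‖²`. Since `‖E X - E Y‖²` and the squared
difference of the standard deviations are both at most `E ‖X - Y‖²`, summing the dissipation
inequality along an admissible trajectory bounds the number of times at which they are large.
-/

namespace StochLQ

section MatrixAction

variable {a b d : ℕ}

theorem mv_zero (M : Matrix (Fin a) (Fin b) ℝ) : mv M (0 : Vec b) = 0 :=
  map_zero _

theorem mv_add (M : Matrix (Fin a) (Fin b) ℝ) (x y : Vec b) : mv M (x + y) = mv M x + mv M y :=
  map_add _ _ _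

theorem mv_sub (M : Matrix (Fin a) (Fin b) ℝ) (x y : Vec b) : mv M (x - y) = mv M x - mv M y :=
  map_sub _ _ _

theorem one_mv (x : Vec a) : mv (1 : Matrix (Fin a) (Fin a) ℝ) x = x := by
  simp [mv]

theorem add_mv (M N : Matrix (Fin a) (Fin b) ℝ) (x : Vec b) : mv (M + N) x = mv M x + mv N x := by
  simp [mv]

theorem smul_mv (t : ℝ) (M : Matrix (Fin a) (Fin b) ℝ) (x : Vec b) : mv (t • M) x = t • mv M x := by
  simp [mv]

theorem mul_mv (M : Matrix (Fin a) (Fin b) ℝ) (N : Matrix (Fin b) (Fin d) ℝ) (x : Vec d) :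
    mv (M * N) x = mv M (mv N x) := by
  simp [mv, Matrix.toLpLin_apply]

theorem mv_apply (M : Matrix (Fin a) (Fin b) ℝ) (x : Vec b) (i : Fin a) :
    mv M x i = ∑ j, M i j * x j := by
  simp [mv, Matrix.toLpLin_apply, Matrix.mulVec, dotProduct]

theorem inner_mv (M : Matrix (Fin a) (Fin b) ℝ) (x : Vec a) (y : Vec b) :
    inner ℝ x (mv M y) = inner ℝ (mv Mᵀ x) y := by
  rw [mv, mv, ← Matrix.conjTranspose_eq_transpose_of_trivial,
    Matrix.toEuclideanLin_conjTranspose_eq_adjoint, LinearMap.adjoint_inner_left]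

theorem inner_mv_left (M : Matrix (Fin a) (Fin b) ℝ) (x : Vec b) (y : Vec a) :
    inner ℝ (mv M x) y = inner ℝ x (mv Mᵀ y) := by
  rw [inner_mv, Matrix.transpose_transpose]

theorem inner_mv_comm {M : Matrix (Fin a) (Fin a) ℝ} (hM : M.IsHermitian) (x y : Vec a) :
    inner ℝ x (mv M y) = inner ℝ y (mv M x) := by
  rw [← real_inner_comm y]
  exact (Matrix.isSymmetric_toEuclideanLin_iff.mpr hM x y).symm

/-- Matrix-vector multiplication as a continuous linear map, linear in the matrix. -/
noncomputable def mvL : Matrix (Fin a) (Fin b) ℝ →ₗ[ℝ] Vec b →L[ℝ] Vec a :=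
  LinearMap.toContinuousLinearMap.toLinearMap ∘ₗ Matrix.toEuclideanLin.toLinearMap

theorem norm_mv_le (M : Matrix (Fin a) (Fin b) ℝ) (x : Vec b) : ‖mv M x‖ ≤ ‖mvL M‖ * ‖x‖ :=
  (mvL M).le_opNorm x

@[fun_prop]
theorem continuous_mv (M : Matrix (Fin a) (Fin b) ℝ) : Continuous (mv M) :=
  (mvL M).continuous

@[fun_prop]
theorem measurable_mv (M : Matrix (Fin a) (Fin b) ℝ) : Measurable (mv M) :=
  (continuous_mv M).measurable

end MatrixAction

section QuadraticForm

variable {a b : ℕ} {M : Matrix (Fin a) (Fin a) ℝ}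

@[fun_prop]
theorem continuous_qf (M : Matrix (Fin a) (Fin a) ℝ) : Continuous (qf M) := by
  unfold qf; fun_prop

theorem qf_one (x : Vec a) : qf (1 : Matrix (Fin a) (Fin a) ℝ) x = ‖x‖ ^ 2 := by
  simp [qf, one_mv]

theorem qf_add_left (M N : Matrix (Fin a) (Fin a) ℝ) (x : Vec a) :
    qf (M + N) x = qf M x + qf N x := by
  simp [qf, add_mv, inner_add_right]

theorem qf_smul_left (t : ℝ) (M : Matrix (Fin a) (Fin a) ℝ) (x : Vec a) :
    qf (t • M) x = t * qf M x := by
  simp [qf, smul_mv, inner_smul_right]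

theorem qf_sum_left {ι : Type*} (s : Finset ι) (M : ι → Matrix (Fin a) (Fin a) ℝ) (x : Vec a) :
    qf (∑ i ∈ s, M i) x = ∑ i ∈ s, qf (M i) x := by
  simp only [qf, mv, map_sum, LinearMap.sum_apply, inner_sum]

theorem qf_transpose_mul_mul (N : Matrix (Fin a) (Fin b) ℝ) (M : Matrix (Fin a) (Fin a) ℝ)
    (x : Vec b) : qf (Nᵀ * M * N) x = qf M (mv N x) := by
  simp only [qf, mul_mv]
  rw [inner_mv, Matrix.transpose_transpose]

theorem qf_transpose_mul_self (N : Matrix (Fin a) (Fin b) ℝ) (x : Vec b) :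
    qf (Nᵀ * N) x = ‖mv N x‖ ^ 2 := by
  rw [← qf_one, ← qf_transpose_mul_mul, Matrix.mul_one]

theorem qf_add_right (hM : M.IsHermitian) (x y : Vec a) :
    qf M (x + y) = qf M x + 2 * inner ℝ x (mv M y) + qf M y := by
  simp only [qf, mv_add, inner_add_left, inner_add_right]
  rw [inner_mv_comm hM y x]; ring

theorem abs_qf_le (M : Matrix (Fin a) (Fin a) ℝ) (x : Vec a) : |qf M x| ≤ ‖mvL M‖ * ‖x‖ ^ 2 :=
  calc |qf M x| ≤ ‖x‖ * ‖mv M x‖ := abs_real_inner_le_norm _ _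
    _ ≤ ‖x‖ * (‖mvL M‖ * ‖x‖) := by gcongr; exact norm_mv_le M x
    _ = ‖mvL M‖ * ‖x‖ ^ 2 := by ring

theorem qf_nonneg (hM : M.PosSemidef) (x : Vec a) : 0 ≤ qf M x :=
  (Matrix.isPositive_toEuclideanLin_iff.mpr hM).re_inner_nonneg_right x

theorem posSemidef_of_qf_nonneg (hM : M.IsHermitian) (h : ∀ x, 0 ≤ qf M x) : M.PosSemidef :=
  Matrix.isPositive_toEuclideanLin_iff.mp
    ⟨Matrix.isSymmetric_toEuclideanLin_iff.mpr hM, fun x => by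
      simpa [real_inner_comm, qf, mv] using h x⟩

theorem posDef_of_qf_pos (hM : M.IsHermitian) (h : ∀ x ≠ 0, 0 < qf M x) : M.PosDef := by
  refine Matrix.PosDef.of_dotProduct_mulVec_pos hM fun {x} hx => ?_
  simpa [qf, mv, Matrix.toLpLin_apply, EuclideanSpace.inner_eq_star_dotProduct, dotProduct_comm]
    using h (WithLp.toLp 2 x) (by simpa using hx)

theorem norm_sq_mv_sqrt (hM : M.PosSemidef) (x : Vec a) : ‖mv (CFC.sqrt M) x‖ ^ 2 = qf M x := by
  have hs : (CFC.sqrt M).IsHermitian :=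
    (Matrix.nonneg_iff_posSemidef.mp (CFC.sqrt_nonneg M)).isHermitian
  rw [← qf_transpose_mul_self, ← Matrix.conjTranspose_eq_transpose_of_trivial, hs.eq,
    CFC.sqrt_mul_sqrt_self M hM.nonneg]

theorem exists_mul_norm_sq_le_qf (hM : M.PosDef) :
    ∃ r > 0, ∀ x : Vec a, r * ‖x‖ ^ 2 ≤ qf M x := by
  have hdet : IsUnit (CFC.sqrt M).det := (Matrix.isUnit_iff_isUnit_det _).mp
    ((CFC.isUnit_sqrt_iff M hM.posSemidef.nonneg).mpr hM.isUnit)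
  set κ := ‖mvL (CFC.sqrt M)⁻¹‖
  refine ⟨(κ ^ 2 + 1)⁻¹, by positivity, fun x => ?_⟩
  have hx : ‖x‖ ^ 2 ≤ κ ^ 2 * qf M x := by
    have hle := norm_mv_le (CFC.sqrt M)⁻¹ (mv (CFC.sqrt M) x)
    rw [← mul_mv, Matrix.nonsing_inv_mul _ hdet, one_mv] at hle
    rw [← norm_sq_mv_sqrt hM.posSemidef, ← mul_pow]
    gcongr
  rw [inv_mul_le_iff₀ (by positivity)]
  linarith [qf_nonneg hM.posSemidef x]

theorem neg_norm_sq_div_le_qf_add_inner {r : ℝ} (hr : 0 < r) {x : Vec a}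
    (hM : r * ‖x‖ ^ 2 ≤ qf M x) (b : Vec a) :
    -(‖b‖ ^ 2 / (4 * r)) ≤ qf M x + inner ℝ b x := by
  have hb : -(‖b‖ * ‖x‖) ≤ inner ℝ b x := (abs_le.mp (abs_real_inner_le_norm b x)).1
  have hsq : ‖b‖ * ‖x‖ - r * ‖x‖ ^ 2 ≤ ‖b‖ ^ 2 / (4 * r) := by
    rw [le_div_iff₀ (by positivity)]
    nlinarith [sq_nonneg (‖b‖ - 2 * r * ‖x‖)]
  linarith

end QuadraticForm

section Stability

variable {d : ℕ} {M V : Matrix (Fin d) (Fin d) ℝ}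

theorem tendsto_pow_zero_of_spectralRadius_lt_one {R : Type*} [NormedRing R] [NormedAlgebra ℂ R]
    [CompleteSpace R] {a : R} (ha : spectralRadius ℂ a < 1) :
    Filter.Tendsto (fun k => a ^ k) Filter.atTop (nhds 0) := by
  obtain ⟨t, hat, ht⟩ := exists_between ha
  have hgelfand := spectrum.pow_nnnorm_pow_one_div_tendsto_nhds_spectralRadius a
  rw [tendsto_zero_iff_enorm_tendsto_zero]
  refine tendsto_of_tendsto_of_tendsto_of_le_of_le' tendsto_const_nhds
    (ENNReal.tendsto_pow_atTop_nhds_zero_of_lt_one ht) (.of_forall fun _ => zero_le) ?_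
  filter_upwards [hgelfand.eventually_lt_const hat, Filter.eventually_ne_atTop 0] with k hk hk0
  rw [one_div] at hk
  exact (ENNReal.rpow_inv_natCast_pow hk0 _).symm.le.trans (pow_le_pow_left' hk.le k)

open scoped Matrix.Norms.Operator in
theorem IsSchurStable.tendsto_pow (hM : IsSchurStable M) :
    Filter.Tendsto (fun k => M ^ k) Filter.atTop (nhds 0) := by
  cases isEmpty_or_nonempty (Fin d)
  · simpa only [Subsingleton.elim _ (0 : Matrix (Fin d) (Fin d) ℝ)] using tendsto_const_nhds
  have hρ : spectralRadius ℂ (M.map (algebraMap ℝ ℂ)) < 1 :=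
    spectrum.spectralRadius_lt_of_forall_lt _ (r := 1) fun μ hμ => by exact_mod_cast hM μ hμ
  have hre : ∀ k, ((M.map (algebraMap ℝ ℂ)) ^ k).map Complex.re = M ^ k := fun k => by
    rw [← Matrix.map_pow]; ext; simp
  simpa only [Function.comp_def, hre, id_eq, Matrix.map_zero _ Complex.zero_re] using
    ((continuous_id.matrix_map Complex.continuous_re).tendsto _).comp
      (tendsto_pow_zero_of_spectralRadius_lt_one hρ)

theorem IsSchurStable.exists_norm_mv_pow_le (hM : IsSchurStable M) {t : ℝ} (ht : 0 < t) :
    ∃ k, ∀ x, ‖mv (M ^ k) x‖ ≤ t * ‖x‖ := by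
  have hlim : Filter.Tendsto (fun k => ‖mvL (M ^ k)‖) Filter.atTop (nhds 0) := by
    have hcont : Continuous fun N : Matrix (Fin d) (Fin d) ℝ => ‖mvL N‖ :=
      mvL.continuous_of_finiteDimensional.norm
    simpa [Function.comp_def] using (hcont.tendsto 0).comp hM.tendsto_pow
  obtain ⟨k, hk⟩ := (hlim.eventually_lt_const ht).exists
  exact ⟨k, fun x => (norm_mv_le _ x).trans (by gcongr)⟩

theorem IsSchurStable.exists_lyapunov (hM : IsSchurStable M) :
    ∃ S : Matrix (Fin d) (Fin d) ℝ, S.PosDef ∧ ∀ x, qf S (mv M x) ≤ qf S x - ‖x‖ ^ 2 := by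
  obtain ⟨k, hk⟩ := hM.exists_norm_mv_pow_le (t := 1 / 2) (by norm_num)
  set T := ∑ i ∈ Finset.range k, (M ^ i)ᵀ * M ^ i
  have hT (x) : qf T x = ∑ i ∈ Finset.range k, ‖mv (M ^ i) x‖ ^ 2 := by
    simp only [T, qf_sum_left, qf_transpose_mul_self]
  have hTM (x) : qf T (mv M x) = qf T x - ‖x‖ ^ 2 + ‖mv (M ^ k) x‖ ^ 2 := by
    have htel := Finset.sum_range_succ' (fun i => ‖mv (M ^ i) x‖ ^ 2) k
    rw [Finset.sum_range_succ, pow_zero, one_mv, ← hT] at htel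
    simp only [hT (mv M x), ← mul_mv, ← pow_succ]
    linarith
  have hdec (x) : qf ((2 : ℝ) • T) (mv M x) ≤ qf ((2 : ℝ) • T) x - ‖x‖ ^ 2 := by
    rw [qf_smul_left, qf_smul_left, hTM]
    nlinarith [hk x, norm_nonneg (mv (M ^ k) x), norm_nonneg x]
  have hT_nonneg (x) : 0 ≤ qf ((2 : ℝ) • T) x := by
    rw [qf_smul_left, hT]; positivity
  have hT_symm : T.IsHermitian := by
    simp [T, Matrix.IsHermitian, Matrix.conjTranspose_eq_transpose_of_trivial,
      Matrix.transpose_sum, Matrix.transpose_mul]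
  refine ⟨(2 : ℝ) • T, posDef_of_qf_pos (hT_symm.smul (.all _)) fun x hx => ?_, hdec⟩
  have hx_pos : 0 < ‖x‖ ^ 2 := by positivity
  linarith [hdec x, hT_nonneg (mv M x)]

/-- Geometric decay of the powers of `M`, the quantitative form of Schur stability. -/
def IsExponentiallyStable (M : Matrix (Fin d) (Fin d) ℝ) : Prop :=
  ∃ C r : ℝ, 0 ≤ r ∧ r < 1 ∧ ∀ k x, ‖mv (M ^ k) x‖ ≤ C * r ^ k * ‖x‖

theorem IsExponentiallyStable.eq_zero_of_mv_eq (hM : IsExponentiallyStable M) {x : Vec d}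
    (hx : mv M x = x) : x = 0 := by
  obtain ⟨C, r, hr0, hr1, hpow⟩ := hM
  have hfix (k : ℕ) : mv (M ^ k) x = x := by
    induction k with
    | zero => rw [pow_zero, one_mv]
    | succ k ih => rw [pow_succ, mul_mv, hx, ih]
  have hlim : Filter.Tendsto (fun k : ℕ => C * r ^ k * ‖x‖) Filter.atTop (nhds 0) := by
    simpa using ((tendsto_pow_atTop_nhds_zero_of_lt_one hr0 hr1).const_mul C).mul_const ‖x‖
  exact norm_le_zero_iff.mp (ge_of_tendsto' hlim fun k => by simpa only [hfix] using hpow k x)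

theorem isExponentiallyStable_of_qf_mv_le (hV : V.PosDef) {t : ℝ} (ht0 : 0 ≤ t) (ht1 : t < 1)
    (h : ∀ x, qf V (mv M x) ≤ t * qf V x) : IsExponentiallyStable M := by
  obtain ⟨s, hs, hVs⟩ := exists_mul_norm_sq_le_qf hV
  have hpow (k x) : qf V (mv (M ^ k) x) ≤ t ^ k * qf V x := by
    induction k with
    | zero => simp [one_mv]
    | succ k ih =>
      rw [pow_succ' M, mul_mv]
      calc qf V (mv M (mv (M ^ k) x)) ≤ t * qf V (mv (M ^ k) x) := h _
        _ ≤ t * (t ^ k * qf V x) := by gcongr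
        _ = t ^ (k + 1) * qf V x := by ring
  refine ⟨√(‖mvL V‖ / s), √t, by positivity, by rwa [Real.sqrt_lt' one_pos, one_pow],
    fun k x => le_of_sq_le_sq ?_ (by positivity)⟩
  have hbound : s * ‖mv (M ^ k) x‖ ^ 2 ≤ t ^ k * (‖mvL V‖ * ‖x‖ ^ 2) :=
    (hVs _).trans ((hpow k x).trans (by gcongr; exact (abs_le.mp (abs_qf_le V x)).2))
  calc ‖mv (M ^ k) x‖ ^ 2 ≤ ‖mvL V‖ / s * t ^ k * ‖x‖ ^ 2 := by
        rw [div_mul_eq_mul_div, div_mul_eq_mul_div, le_div_iff₀ hs]; linarith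
    _ = (√(‖mvL V‖ / s) * √t ^ k * ‖x‖) ^ 2 := by
        rw [mul_pow, mul_pow, pow_right_comm, Real.sq_sqrt (by positivity), Real.sq_sqrt ht0]

theorem isExponentiallyStable_of_lyapunov (hV : V.PosDef) {c : ℝ} (hc : 0 < c)
    (h : ∀ x, qf V (mv M x) ≤ qf V x - c * ‖x‖ ^ 2) : IsExponentiallyStable M := by
  set κ := ‖mvL V‖ + c
  have hκ : 0 < κ := by positivity
  have hcκ : c / κ ≤ 1 := (div_le_one hκ).mpr (le_add_of_nonneg_left (norm_nonneg _))
  refine isExponentiallyStable_of_qf_mv_le hV (t := 1 - c / κ) (by linarith)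
    (by linarith [div_pos hc hκ]) fun x => ?_
  have hVκ : qf V x ≤ κ * ‖x‖ ^ 2 :=
    (abs_le.mp (abs_qf_le V x)).2.trans (by gcongr; exact le_add_of_nonneg_right hc.le)
  have hle : c / κ * qf V x ≤ c * ‖x‖ ^ 2 := by
    rw [div_mul_eq_mul_div, div_le_iff₀ hκ]; nlinarith
  linarith [h x]

end Stability

section Detectability

variable {n l p : ℕ}

theorem exists_qf_mv_add_le {a b : ℕ} {S : Matrix (Fin a) (Fin a) ℝ} (hS : S.IsHermitian)
    (M : Matrix (Fin a) (Fin b) ℝ) {t : ℝ} (ht : 0 < t) :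
    ∃ κ, 0 ≤ κ ∧ ∀ x g, qf S (mv M x + g) ≤ qf S (mv M x) + t * ‖x‖ ^ 2 + κ * ‖g‖ ^ 2 := by
  set τ := ‖mvL M‖ * ‖mvL S‖
  refine ⟨τ ^ 2 / t + ‖mvL S‖, by positivity, fun x g => ?_⟩
  have hcross : inner ℝ (mv M x) (mv S g) ≤ τ * ‖x‖ * ‖g‖ :=
    calc inner ℝ (mv M x) (mv S g) ≤ ‖mv M x‖ * ‖mv S g‖ := real_inner_le_norm _ _
      _ ≤ (‖mvL M‖ * ‖x‖) * (‖mvL S‖ * ‖g‖) := by gcongr <;> apply norm_mv_le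
      _ = τ * ‖x‖ * ‖g‖ := by ring
  have hyoung : 2 * (τ * ‖x‖ * ‖g‖) ≤ t * ‖x‖ ^ 2 + τ ^ 2 / t * ‖g‖ ^ 2 := by
    have hsq : 0 ≤ (t * ‖x‖ - τ * ‖g‖) ^ 2 / t := by positivity
    have hexpand : (t * ‖x‖ - τ * ‖g‖) ^ 2 / t
        = t * ‖x‖ ^ 2 - 2 * (τ * ‖x‖ * ‖g‖) + τ ^ 2 / t * ‖g‖ ^ 2 := by field_simp; ring
    linarith
  rw [qf_add_right hS]
  linarith [(abs_le.mp (abs_qf_le S g)).2]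

theorem exists_norm_mv_sub_mv_sq_le {a : ℕ} {Q : Matrix (Fin n) (Fin n) ℝ}
    {R : Matrix (Fin l) (Fin l) ℝ} (hQ : Q.PosSemidef) (hR : R.PosDef)
    (B : Matrix (Fin a) (Fin l) ℝ) (L : Matrix (Fin a) (Fin n) ℝ) :
    ∃ κ, 0 ≤ κ ∧ ∀ x u, ‖mv B u - mv L (mv (CFC.sqrt Q) x)‖ ^ 2 ≤ κ * (qf Q x + qf R u) := by
  obtain ⟨r, hr, hRr⟩ := exists_mul_norm_sq_le_qf hR
  set β := 2 * ‖mvL B‖ ^ 2 / r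
  set τ := 2 * ‖mvL L‖ ^ 2
  refine ⟨β + τ, by positivity, fun x u => ?_⟩
  have hB : 2 * ‖mv B u‖ ^ 2 ≤ β * qf R u :=
    calc 2 * ‖mv B u‖ ^ 2 ≤ 2 * (‖mvL B‖ * ‖u‖) ^ 2 := by gcongr; exact norm_mv_le B u
      _ = β * (r * ‖u‖ ^ 2) := by simp only [β]; field_simp
      _ ≤ β * qf R u := by gcongr; exact hRr u
  have hL : 2 * ‖mv L (mv (CFC.sqrt Q) x)‖ ^ 2 ≤ τ * qf Q x :=
    calc 2 * ‖mv L (mv (CFC.sqrt Q) x)‖ ^ 2 ≤ 2 * (‖mvL L‖ * ‖mv (CFC.sqrt Q) x‖) ^ 2 := by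
          gcongr; exact norm_mv_le L _
      _ = τ * qf Q x := by rw [mul_pow, norm_sq_mv_sqrt hQ]; ring
  have hQR : 0 ≤ β * qf Q x + τ * qf R u := by
    have hQ0 := qf_nonneg hQ x
    have hR0 := qf_nonneg hR.posSemidef u
    positivity
  have hpar := parallelogram_law_with_norm ℝ (mv B u) (mv L (mv (CFC.sqrt Q) x))
  nlinarith [sq_nonneg ‖mv B u + mv L (mv (CFC.sqrt Q) x)‖]

/-- `x ↦ xᵀ S x` is a storage function of the linear system `x⁺ = A x + B u` with supply rate
`xᵀ Q₁ x + uᵀ R₁ u`, strict at the origin with rate `c ‖x‖²`. -/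
structure Data.IsStorageMatrix {m : ℕ} (D : Data n l m) (S : Matrix (Fin n) (Fin n) ℝ)
    (c : ℝ) : Prop where
  posDef : S.PosDef
  rate_pos : 0 < c
  le : ∀ x u, c * ‖x‖ ^ 2 ≤ qf D.Q₁ x + qf D.R₁ u + qf S x - qf S (mv D.A x + mv D.B u)

theorem exists_isStorageMatrix {m : ℕ} {D : Data n l m} (hQ₁ : D.Q₁.PosSemidef)
    (hR₁ : D.R₁.PosDef) (hdet : IsDetectable D.A (CFC.sqrt D.Q₁)) :
    ∃ S c, D.IsStorageMatrix S c := by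
  obtain ⟨L, hL⟩ := hdet
  obtain ⟨S, hS, hdec⟩ := hL.exists_lyapunov
  obtain ⟨κ, hκ0, hκ⟩ := exists_qf_mv_add_le hS.isHermitian (D.A + L * CFC.sqrt D.Q₁)
    (t := 1 / 2) (by norm_num)
  obtain ⟨τ, hτ0, hτ⟩ := exists_norm_mv_sub_mv_sq_le hQ₁ hR₁ D.B L
  set γ := κ * τ + 1
  have hγ : 0 < γ := by positivity
  refine ⟨γ⁻¹ • S, γ⁻¹ / 2, hS.smul (inv_pos.mpr hγ), by positivity, fun x u => ?_⟩
  -- output injection: view `x⁺` as the stable dynamics `A + L √Q₁` driven by `B u - L √Q₁ x`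
  have hsplit : mv D.A x + mv D.B u = mv (D.A + L * CFC.sqrt D.Q₁) x
      + (mv D.B u - mv L (mv (CFC.sqrt D.Q₁) x)) := by
    rw [add_mv, mul_mv]; abel
  have hS_le : qf S (mv D.A x + mv D.B u)
      ≤ qf S x - ‖x‖ ^ 2 / 2 + γ * (qf D.Q₁ x + qf D.R₁ u) := by
    have hg := mul_le_mul_of_nonneg_left (hτ x u) hκ0
    rw [hsplit]
    linarith [hκ x (mv D.B u - mv L (mv (CFC.sqrt D.Q₁) x)), hdec x, qf_nonneg hQ₁ x,
      qf_nonneg hR₁.posSemidef u]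
  rw [qf_smul_left, qf_smul_left, ← mul_le_mul_iff_right₀ hγ]
  field_simp
  linarith

end Detectability

section Riccati

variable {n l m : ℕ} {D : Data n l m} {P S : Matrix (Fin n) (Fin n) ℝ}

/-- The right-hand side of the algebraic Riccati equation, as an operator on matrices. -/
noncomputable def Data.riccatiMap (D : Data n l m) (P : Matrix (Fin n) (Fin n) ℝ) :
    Matrix (Fin n) (Fin n) ℝ :=
  D.Aᵀ * P * D.A + (D.Q₁ + D.Q₂)
    - D.Aᵀ * P * D.B * ((D.R₁ + D.R₂) + D.Bᵀ * P * D.B)⁻¹ * D.Bᵀ * P * D.A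

/-- The matrix `A + B K` of the closed loop under the feedback gain `K = D.gain P`. -/
noncomputable def Data.closedLoop (D : Data n l m) (P : Matrix (Fin n) (Fin n) ℝ) :
    Matrix (Fin n) (Fin n) ℝ :=
  D.A + D.B * D.gain P

theorem closedLoop_mv (P : Matrix (Fin n) (Fin n) ℝ) (x : Vec n) :
    mv (D.closedLoop P) x = mv D.A x + mv D.B (mv (D.gain P) x) := by
  rw [Data.closedLoop, add_mv, mul_mv]

theorem posSemidef_transpose_mul_mul {a b : ℕ} {M : Matrix (Fin a) (Fin a) ℝ}
    (hM : M.PosSemidef) (N : Matrix (Fin a) (Fin b) ℝ) : (Nᵀ * M * N).PosSemidef := by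
  simpa only [Matrix.conjTranspose_eq_transpose_of_trivial] using hM.conjTranspose_mul_mul_same N

theorem posDef_inputWeight (hR : (D.R₁ + D.R₂).PosDef) (hP : P.PosSemidef) :
    ((D.R₁ + D.R₂) + D.Bᵀ * P * D.B).PosDef :=
  hR.add_posSemidef (posSemidef_transpose_mul_mul hP D.B)

theorem inputWeight_mul_gain (hR : (D.R₁ + D.R₂).PosDef) (hP : P.PosSemidef) :
    (D.R₁ + D.R₂) * D.gain P + D.Bᵀ * P * D.closedLoop P = 0 := by
  have hdet := (Matrix.isUnit_iff_isUnit_det _).mp (posDef_inputWeight hR hP).isUnit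
  have hgain : ((D.R₁ + D.R₂) + D.Bᵀ * P * D.B) * D.gain P = -(D.Bᵀ * P * D.A) := by
    rw [Data.gain, Matrix.mul_neg, Matrix.mul_assoc _ D.Bᵀ, Matrix.mul_assoc _ (D.Bᵀ * P),
      Matrix.mul_nonsing_inv_cancel_left _ _ hdet]
  rw [Matrix.add_mul, ← eq_sub_iff_add_eq] at hgain
  rw [hgain, Data.closedLoop, Matrix.mul_add, Matrix.mul_assoc _ D.B]
  abel

theorem riccatiMap_eq (P : Matrix (Fin n) (Fin n) ℝ) :
    D.riccatiMap P = (D.Q₁ + D.Q₂) + D.Aᵀ * P * D.closedLoop P := by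
  simp only [Data.riccatiMap, Data.closedLoop, Data.gain, Matrix.mul_add, Matrix.mul_neg,
    Matrix.mul_assoc]
  abel

theorem riccatiMap_eq_sum (hR : (D.R₁ + D.R₂).PosDef) (hP : P.PosSemidef) :
    D.riccatiMap P = (D.Q₁ + D.Q₂) + (D.gain P)ᵀ * (D.R₁ + D.R₂) * D.gain P
      + (D.closedLoop P)ᵀ * P * D.closedLoop P := by
  have hgain : (D.gain P)ᵀ * (D.R₁ + D.R₂) * D.gain P
      + (D.gain P)ᵀ * D.Bᵀ * P * D.closedLoop P = 0 := by
    simpa only [Matrix.mul_add, Matrix.add_mul, Matrix.mul_zero, Matrix.mul_assoc] using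
      congrArg ((D.gain P)ᵀ * ·) (inputWeight_mul_gain hR hP)
  have hclosed : (D.closedLoop P)ᵀ = D.Aᵀ + (D.gain P)ᵀ * D.Bᵀ := by
    rw [Data.closedLoop, Matrix.transpose_add, Matrix.transpose_mul]
  rw [riccatiMap_eq, hclosed, Matrix.add_mul, Matrix.add_mul, add_assoc (D.Q₁ + D.Q₂),
    add_left_comm _ (_ * D.closedLoop P), hgain, add_zero]

theorem posSemidef_riccatiMap (hQ : (D.Q₁ + D.Q₂).PosSemidef) (hR : (D.R₁ + D.R₂).PosDef)
    (hP : P.PosSemidef) : (D.riccatiMap P).PosSemidef := by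
  rw [riccatiMap_eq_sum hR hP]
  exact (hQ.add (posSemidef_transpose_mul_mul hR.posSemidef _)).add
    (posSemidef_transpose_mul_mul hP _)

theorem qf_riccatiMap (hR : (D.R₁ + D.R₂).PosDef) (hP : P.PosSemidef) (x : Vec n) :
    qf (D.riccatiMap P) x = qf (D.Q₁ + D.Q₂) x + qf (D.R₁ + D.R₂) (mv (D.gain P) x)
      + qf P (mv (D.closedLoop P) x) := by
  rw [riccatiMap_eq_sum hR hP, qf_add_left, qf_add_left _ (_ * _ * _), qf_transpose_mul_mul,
    qf_transpose_mul_mul]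

theorem inner_inputWeight_gain (hR : (D.R₁ + D.R₂).PosDef) (hP : P.PosSemidef) (x : Vec n)
    (u : Vec l) : inner ℝ u (mv (D.R₁ + D.R₂) (mv (D.gain P) x))
      + inner ℝ (mv D.B u) (mv P (mv (D.closedLoop P) x)) = 0 := by
  rw [inner_mv_left, ← inner_add_right, ← mul_mv, ← mul_mv, ← mul_mv, ← add_mv,
    inputWeight_mul_gain hR hP]
  simp [mv]

theorem qf_riccatiMap_le (hR : (D.R₁ + D.R₂).PosDef) (hP : P.PosSemidef) (x : Vec n)
    (u : Vec l) : qf (D.riccatiMap P) x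
      ≤ qf (D.Q₁ + D.Q₂) x + qf (D.R₁ + D.R₂) u + qf P (mv D.A x + mv D.B u) := by
  set e := u - mv (D.gain P) x
  have hu : u = mv (D.gain P) x + e := (add_sub_cancel _ _).symm
  have hx : mv D.A x + mv D.B u = mv (D.closedLoop P) x + mv D.B e := by
    rw [hu, mv_add, closedLoop_mv]; abel
  rw [hx, hu, qf_add_right hR.isHermitian, qf_add_right hP.isHermitian, qf_riccatiMap hR hP]
  have hcross := inner_inputWeight_gain hR hP x e
  rw [inner_mv_comm hR.isHermitian, inner_mv_comm hP.isHermitian]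
  linarith [qf_nonneg hR.posSemidef e, qf_nonneg hP (mv D.B e)]

theorem le_iff_qf_le {d : ℕ} {M N : Matrix (Fin d) (Fin d) ℝ} (hM : M.IsHermitian)
    (hN : N.IsHermitian) : M ≤ N ↔ ∀ x, qf M x ≤ qf N x := by
  have hsub (x) : qf (N - M) x = qf N x - qf M x := by
    rw [eq_sub_iff_add_eq, ← qf_add_left, sub_add_cancel]
  rw [Matrix.le_iff]
  refine ⟨fun h x => ?_, fun h => posSemidef_of_qf_nonneg (hN.sub hM) fun x => ?_⟩
  · linarith [hsub x, qf_nonneg h x]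
  · linarith [hsub x, h x]

theorem continuous_qf_left {d : ℕ} (x : Vec d) :
    Continuous fun M : Matrix (Fin d) (Fin d) ℝ => qf M x :=
  continuous_const.inner (((ContinuousLinearMap.apply ℝ _ x).continuous).comp
    mvL.continuous_of_finiteDimensional)

theorem apply_eq_qf_sub_div {d : ℕ} {M : Matrix (Fin d) (Fin d) ℝ} (hM : M.IsHermitian)
    (i j : Fin d) : M i j = (qf M (EuclideanSpace.single i 1 + EuclideanSpace.single j 1)
      - qf M (EuclideanSpace.single i 1) - qf M (EuclideanSpace.single j 1)) / 2 := by
  have hij : inner ℝ (EuclideanSpace.single i (1 : ℝ)) (mv M (EuclideanSpace.single j 1))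
      = M i j := by
    simp [EuclideanSpace.inner_single_left, mv_apply]
  rw [qf_add_right hM, hij]
  ring

theorem exists_tendsto_of_monotone {d : ℕ} {M : ℕ → Matrix (Fin d) (Fin d) ℝ} (hM : Monotone M)
    (hsymm : ∀ k, (M k).IsHermitian) {T : Matrix (Fin d) (Fin d) ℝ} (hT : T.IsHermitian)
    (hbdd : ∀ k, M k ≤ T) : ∃ P, Filter.Tendsto M Filter.atTop (nhds P) := by
  have hqf (x) : ∃ t, Filter.Tendsto (fun k => qf (M k) x) Filter.atTop (nhds t) :=
    ⟨_, tendsto_atTop_ciSup (fun i j hij => (le_iff_qf_le (hsymm i) (hsymm j)).mp (hM hij) x)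
      ⟨qf T x, by rintro _ ⟨k, rfl⟩; exact (le_iff_qf_le (hsymm k) hT).mp (hbdd k) x⟩⟩
  choose t ht using hqf
  refine ⟨Matrix.of fun i j => (t (EuclideanSpace.single i 1 + EuclideanSpace.single j 1)
      - t (EuclideanSpace.single i 1) - t (EuclideanSpace.single j 1)) / 2,
    tendsto_pi_nhds.mpr fun i => tendsto_pi_nhds.mpr fun j => ?_⟩
  simp only [apply_eq_qf_sub_div (hsymm _), Matrix.of_apply]
  exact (((ht _).sub (ht _)).sub (ht _)).div_const 2

theorem posSemidef_of_tendsto {d : ℕ} {M : ℕ → Matrix (Fin d) (Fin d) ℝ}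
    {P : Matrix (Fin d) (Fin d) ℝ} (hM : ∀ k, (M k).PosSemidef)
    (hP : Filter.Tendsto M Filter.atTop (nhds P)) : P.PosSemidef := by
  refine posSemidef_of_qf_nonneg (tendsto_nhds_unique (f := M) ?_ hP) fun x =>
    ge_of_tendsto' (((continuous_qf_left x).tendsto P).comp hP) fun k => qf_nonneg (hM k) x
  simpa only [Function.comp_def, id, (hM _).isHermitian.eq] using
    (continuous_id.matrix_conjTranspose.tendsto P).comp hP

theorem riccatiMap_mono (hQ : (D.Q₁ + D.Q₂).PosSemidef) (hR : (D.R₁ + D.R₂).PosDef)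
    (hP : P.PosSemidef) (hS : S.PosSemidef) (hPS : P ≤ S) : D.riccatiMap P ≤ D.riccatiMap S := by
  rw [le_iff_qf_le (posSemidef_riccatiMap hQ hR hP).isHermitian
    (posSemidef_riccatiMap hQ hR hS).isHermitian]
  intro x
  refine (qf_riccatiMap_le hR hP x (mv (D.gain S) x)).trans ?_
  rw [← closedLoop_mv, qf_riccatiMap hR hS]
  exact add_le_add_right ((le_iff_qf_le hP.isHermitian hS.isHermitian).mp hPS _) _

theorem posSemidef_riccatiMap_iterate (hQ : (D.Q₁ + D.Q₂).PosSemidef) (hR : (D.R₁ + D.R₂).PosDef)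
    (k : ℕ) : (D.riccatiMap^[k] 0).PosSemidef := by
  induction k with
  | zero => exact Matrix.PosSemidef.zero
  | succ k ih =>
    rw [Function.iterate_succ_apply']
    exact posSemidef_riccatiMap hQ hR ih

theorem monotone_riccatiMap_iterate (hQ : (D.Q₁ + D.Q₂).PosSemidef)
    (hR : (D.R₁ + D.R₂).PosDef) : Monotone fun k => D.riccatiMap^[k] 0 := by
  refine monotone_nat_of_le_succ fun k => ?_
  induction k with
  | zero => exact (posSemidef_riccatiMap_iterate hQ hR 1).nonneg
  | succ k ih =>
    rw [Function.iterate_succ_apply' _ k, Function.iterate_succ_apply' _ (k + 1)]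
    exact riccatiMap_mono hQ hR (posSemidef_riccatiMap_iterate hQ hR k)
      (posSemidef_riccatiMap_iterate hQ hR (k + 1)) ih

theorem exists_riccatiMap_le (hAB : IsStabilizable D.A D.B) (hQ : (D.Q₁ + D.Q₂).PosSemidef)
    (hR : (D.R₁ + D.R₂).PosDef) : ∃ T, T.PosSemidef ∧ D.riccatiMap T ≤ T := by
  obtain ⟨F, hF⟩ := hAB
  obtain ⟨V, hV, hdec⟩ := hF.exists_lyapunov
  set N := (D.Q₁ + D.Q₂) + Fᵀ * (D.R₁ + D.R₂) * F
  have hT : (‖mvL N‖ • V).PosSemidef := hV.posSemidef.smul (norm_nonneg _)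
  refine ⟨_, hT, (le_iff_qf_le (posSemidef_riccatiMap hQ hR hT).isHermitian
    hT.isHermitian).mpr fun x => (qf_riccatiMap_le hR hT x (mv F x)).trans ?_⟩
  have hN : qf (D.Q₁ + D.Q₂) x + qf (D.R₁ + D.R₂) (mv F x) ≤ ‖mvL N‖ * ‖x‖ ^ 2 := by
    rw [← qf_transpose_mul_mul, ← qf_add_left]
    exact (abs_le.mp (abs_qf_le N x)).2
  rw [← mul_mv, ← add_mv, qf_smul_left, qf_smul_left]
  linarith [mul_le_mul_of_nonneg_left (hdec x) (norm_nonneg (mvL N))]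

theorem continuousAt_riccatiMap (hR : (D.R₁ + D.R₂).PosDef) (hP : P.PosSemidef) :
    ContinuousAt D.riccatiMap P := by
  set G := fun X : Matrix (Fin n) (Fin n) ℝ => (D.R₁ + D.R₂) + D.Bᵀ * X * D.B
  have hinv : ContinuousAt (fun X => (G X)⁻¹) P := by
    refine ContinuousAt.comp (f := G) (continuousAt_matrix_inv _ ?_)
      (by fun_prop : Continuous G).continuousAt
    rw [Ring.inverse_eq_inv']
    exact continuousAt_inv₀ (posDef_inputWeight hR hP).det_pos.ne'
  have hjoint : Continuous fun X : Matrix (Fin n) (Fin n) ℝ × Matrix (Fin l) (Fin l) ℝ =>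
      D.Aᵀ * X.1 * D.A + (D.Q₁ + D.Q₂) - D.Aᵀ * X.1 * D.B * X.2 * D.Bᵀ * X.1 * D.A := by
    fun_prop
  exact ContinuousAt.comp (f := fun X => (X, (G X)⁻¹)) hjoint.continuousAt
    (continuousAt_id.prodMk hinv)

theorem exists_isRiccatiSolution (hAB : IsStabilizable D.A D.B)
    (hQ : (D.Q₁ + D.Q₂).PosSemidef) (hR : (D.R₁ + D.R₂).PosDef) :
    ∃ P, D.IsRiccatiSolution P := by
  have hpsd := posSemidef_riccatiMap_iterate hQ hR
  obtain ⟨T, hT, hTle⟩ := exists_riccatiMap_le hAB hQ hR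
  have hbdd (k : ℕ) : D.riccatiMap^[k] 0 ≤ T := by
    induction k with
    | zero => exact hT.nonneg
    | succ k ih =>
      rw [Function.iterate_succ_apply']
      exact (riccatiMap_mono hQ hR (hpsd k) hT ih).trans hTle
  obtain ⟨P, hP⟩ := exists_tendsto_of_monotone (monotone_riccatiMap_iterate hQ hR)
    (fun k => (hpsd k).isHermitian) hT.isHermitian hbdd
  have hPpsd : P.PosSemidef := posSemidef_of_tendsto hpsd hP
  exact ⟨P, hPpsd, (isFixedPt_of_tendsto_iterate hP (continuousAt_riccatiMap hR hPpsd)).symm⟩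

theorem isExponentiallyStable_closedLoop (hQ₂ : D.Q₂.PosSemidef) (hR₂ : D.R₂.PosSemidef)
    (hR : (D.R₁ + D.R₂).PosDef) (hP : D.IsRiccatiSolution P) {c : ℝ}
    (hS : D.IsStorageMatrix S c) : IsExponentiallyStable (D.closedLoop P) := by
  refine isExponentiallyStable_of_lyapunov (hS.posDef.add_posSemidef hP.1) hS.rate_pos fun x => ?_
  have hS_le := hS.le x (mv (D.gain P) x)
  have hP_eq : qf P x = _ := (congrArg (qf · x) hP.2).trans (qf_riccatiMap hR hP.1 x)
  rw [← closedLoop_mv] at hS_le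
  simp only [qf_add_left] at hP_eq ⊢
  linarith [qf_nonneg hQ₂ x, qf_nonneg hR₂ (mv (D.gain P) x)]

end Riccati

section OptimalSteadyState

theorem exists_lagrange_multiplier {K V F : Type*} [Field K] [AddCommGroup V] [Module K V]
    [FiniteDimensional K V] [AddCommGroup F] [Module K F] (a : V →ₗ[K] V →ₗ[K] K)
    (g : Module.Dual K V) (T : V →ₗ[K] F) (ha : ∀ p, T p = 0 → a p p = 0 → p = 0) (p₀ : V) :
    ∃ p, T p = T p₀ ∧ ∃ ψ : Module.Dual K F, ∀ w, a p w + g w = ψ (T w) := by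
  let φ : LinearMap.ker T →ₗ[K] Module.Dual K (LinearMap.ker T) := a.domRestrict₁₂ _ _
  have hinj : Function.Injective φ :=
    (injective_iff_map_eq_zero φ).mpr fun p hp =>
      Subtype.ext (ha p p.2 (LinearMap.congr_fun hp p))
  obtain ⟨p, hp⟩ := (LinearMap.injective_iff_surjective_of_finrank_eq_finrank
    Subspace.dual_finrank_eq.symm).mp hinj (-(a p₀ + g).domRestrict (LinearMap.ker T))
  have hker : a (p₀ + p) + g ∈ LinearMap.range T.dualMap := by
    rw [LinearMap.range_dualMap_eq_dualAnnihilator_ker, Submodule.mem_dualAnnihilator]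
    intro w hw
    have hpw : a p w = -(a p₀ w + g w) := LinearMap.congr_fun hp ⟨w, hw⟩
    rw [map_add, LinearMap.add_apply, LinearMap.add_apply, hpw]
    ring
  obtain ⟨ψ, hψ⟩ := hker
  have hTp : T p = 0 := p.2
  exact ⟨p₀ + p, by rw [map_add, hTp, add_zero], ψ, fun w => (LinearMap.congr_fun hψ w).symm⟩

variable {n l m : ℕ}

/-- `(x, u)` is an equilibrium of the dynamics with the noise replaced by its mean `μ`. -/
def Data.IsSteadyState (D : Data n l m) (μ : Vec m) (x : Vec n) (u : Vec l) : Prop :=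
  x - mv D.A x - mv D.B u = mv D.E μ + D.z

/-- Stationarity of the Lagrangian of the steady-state problem, i.e. of minimizing
`xᵀ Q₁ x + uᵀ R₁ u + sᵀ x + vᵀ u` over the steady states, at `(x, u)` with multiplier `q`. -/
def Data.IsKKTPoint (D : Data n l m) (x : Vec n) (u : Vec l) (q : Vec n) : Prop :=
  ∀ d w, 2 * inner ℝ d (mv D.Q₁ x) + inner ℝ D.s d + (2 * inner ℝ w (mv D.R₁ u) + inner ℝ D.v w)
    + inner ℝ q (d - (mv D.A d + mv D.B w)) = 0

variable {D : Data n l m} {S : Matrix (Fin n) (Fin n) ℝ} {c : ℝ}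

theorem Data.IsStorageMatrix.eq_zero_of_steady (hS : D.IsStorageMatrix S c)
    (hQ₁ : D.Q₁.PosSemidef) (hR₁ : D.R₁.PosDef) {x : Vec n} {u : Vec l}
    (hxu : mv D.A x + mv D.B u = x) (hcost : qf D.Q₁ x + qf D.R₁ u = 0) : x = 0 ∧ u = 0 := by
  constructor
  · have hx := hS.le x u
    rw [hxu, hcost, zero_add, sub_self] at hx
    exact norm_eq_zero.mp (sq_eq_zero_iff.mp
      (le_antisymm (nonpos_of_mul_nonpos_right hx hS.rate_pos) (sq_nonneg _)))
  · obtain ⟨r, hr, hRr⟩ := exists_mul_norm_sq_le_qf hR₁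
    have hu : r * ‖u‖ ^ 2 ≤ 0 := by linarith [hRr u, qf_nonneg hQ₁ x]
    exact norm_eq_zero.mp (sq_eq_zero_iff.mp
      (le_antisymm (nonpos_of_mul_nonpos_right hu hr) (sq_nonneg _)))

theorem exists_isKKTPoint (hQ₁ : D.Q₁.PosSemidef) (hR₁ : D.R₁.PosDef)
    (hS : D.IsStorageMatrix S c) {μ : Vec m} {xs : Vec n} {us : Vec l}
    (hs : D.IsSteadyState μ xs us) :
    ∃ x u q, D.IsSteadyState μ x u ∧ D.IsKKTPoint x u q := by
  let X : Vec n × Vec l →ₗ[ℝ] Vec n := LinearMap.fst ℝ _ _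
  let U : Vec n × Vec l →ₗ[ℝ] Vec l := LinearMap.snd ℝ _ _
  let T : Vec n × Vec l →ₗ[ℝ] Vec n :=
    X - (Matrix.toEuclideanLin D.A ∘ₗ X + Matrix.toEuclideanLin D.B ∘ₗ U)
  have hT : ∀ x u, T (x, u) = x - (mv D.A x + mv D.B u) := fun _ _ => rfl
  let a : Vec n × Vec l →ₗ[ℝ] Vec n × Vec l →ₗ[ℝ] ℝ :=
    (2 : ℝ) • ((innerₗ (Vec n)).compl₁₂ (Matrix.toEuclideanLin D.Q₁ ∘ₗ X) X
      + (innerₗ (Vec l)).compl₁₂ (Matrix.toEuclideanLin D.R₁ ∘ₗ U) U)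
  have ha : ∀ x u d w, a (x, u) (d, w) = 2 * (inner ℝ d (mv D.Q₁ x) + inner ℝ w (mv D.R₁ u)) :=
    fun x u d w => by rw [real_inner_comm, real_inner_comm (mv D.R₁ u)]; rfl
  let g : Vec n × Vec l →ₗ[ℝ] ℝ := innerₗ (Vec n) D.s ∘ₗ X + innerₗ (Vec l) D.v ∘ₗ U
  have hdefinite : ∀ p, T p = 0 → a p p = 0 → p = 0 := by
    rintro ⟨x, u⟩ hp hcost
    obtain ⟨rfl, rfl⟩ := hS.eq_zero_of_steady hQ₁ hR₁ (sub_eq_zero.mp ((hT x u).symm.trans hp)).symm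
      ((mul_eq_zero.mp ((ha x u x u).symm.trans hcost)).resolve_left two_ne_zero)
    rfl
  obtain ⟨⟨x, u⟩, hxu, ψ, hψ⟩ := exists_lagrange_multiplier a g T hdefinite (xs, us)
  refine ⟨x, u, -(InnerProductSpace.toDual ℝ (Vec n)).symm (LinearMap.toContinuousLinearMap ψ),
    ?_, fun d w => ?_⟩
  · rw [hT, hT, ← sub_sub, ← sub_sub] at hxu
    exact hxu.trans hs
  · have hdw := hψ (d, w)
    rw [ha, hT] at hdw
    change _ + (inner ℝ D.s d + inner ℝ D.v w) = _ at hdw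
    rw [inner_neg_left, InnerProductSpace.toDual_symm_apply,
      LinearMap.coe_toContinuousLinearMap', ← hdw]
    ring

end OptimalSteadyState

section RandomRecursion

variable {Ω : Type*} [MeasurableSpace Ω] {Pr : Measure Ω}

theorem indepFun_prodMk_of_indepFun [IsFiniteMeasure Pr] {𝓧 𝓨 𝓩 : Type*} [MeasurableSpace 𝓧]
    [MeasurableSpace 𝓨] [MeasurableSpace 𝓩] {X : Ω → 𝓧} {Y : Ω → 𝓨} {Z : Ω → 𝓩}
    (hX : Measurable X) (hY : Measurable Y) (hZ : Measurable Z)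
    (hXYZ : IndepFun X (fun ω => (Y ω, Z ω)) Pr) (hYZ : IndepFun Y Z Pr) :
    IndepFun (fun ω => (X ω, Y ω)) Z Pr := by
  have hXY : IndepFun X Y Pr := hXYZ.comp measurable_id measurable_fst
  rw [indepFun_iff_map_prod_eq_prod_map_map (by fun_prop) (by fun_prop)] at hXYZ hYZ hXY ⊢
  rw [hXY, ← (measurePreserving_prodAssoc (Pr.map X) (Pr.map Y) (Pr.map Z)).symm.map_eq, ← hYZ,
    ← hXYZ, Measure.map_map (MeasurableEquiv.measurable _) (by fun_prop)]
  rfl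

variable {𝓧 𝓦 : Type*} [MeasurableSpace 𝓧] [MeasurableSpace 𝓦] {W : ℕ → Ω → 𝓦}

theorem indepFun_tail (hWm : ∀ k, Measurable (W k)) (hW : iIndepFun W Pr) (k : ℕ) :
    IndepFun (W k) (fun ω j => W (k + 1 + j) ω) Pr := by
  refine indep_of_indep_of_le_left (indep_of_indep_of_le_right (indep_iSup_of_disjoint
    (fun i => (hWm i).comap_le) hW (S := {k}) (T := Set.Ioi k) (by simp)) ?_)
    (le_iSup₂_of_le k rfl le_rfl)
  refine measurable_iff_comap_le.mp (@measurable_pi_lambda _ _ _ (_) _ _ fun j => ?_)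
  exact measurable_iff_comap_le.mpr
    (le_iSup₂_of_le (k + 1 + j) (Set.mem_Ioi.mpr (by omega)) le_rfl)

variable {g : 𝓧 × 𝓦 → 𝓧} {X : ℕ → Ω → 𝓧}

theorem measurable_of_recursion (hWm : ∀ k, Measurable (W k)) (hg : Measurable g)
    (hX₀ : Measurable (X 0)) (hX : ∀ k ω, X (k + 1) ω = g (X k ω, W k ω)) (k : ℕ) :
    Measurable (X k) := by
  induction k with
  | zero => exact hX₀
  | succ k ih =>
    rw [funext (hX k)]
    exact hg.comp (ih.prodMk (hWm k))

variable [IsFiniteMeasure Pr]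

theorem indepFun_tail_of_recursion (hWm : ∀ k, Measurable (W k)) (hW : iIndepFun W Pr)
    (hg : Measurable g) (hX₀ : Measurable (X 0)) (hX₀W : IndepFun (X 0) (fun ω k => W k ω) Pr)
    (hX : ∀ k ω, X (k + 1) ω = g (X k ω, W k ω)) (k : ℕ) :
    IndepFun (X k) (fun ω j => W (k + j) ω) Pr := by
  induction k with
  | zero => simpa only [zero_add] using hX₀W
  | succ k ih =>
    have hsplit : IndepFun (X k) (fun ω => (W k ω, fun j => W (k + 1 + j) ω)) Pr := by
      have hshift : Measurable fun w : ℕ → 𝓦 => (w 0, fun j => w (1 + j)) := by fun_prop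
      simpa only [Function.comp_def, id, add_zero, ← add_assoc] using
        ih.comp measurable_id hshift
    rw [funext (hX k)]
    exact (indepFun_prodMk_of_indepFun (measurable_of_recursion hWm hg hX₀ hX k) (hWm k)
      (measurable_pi_lambda _ fun j => hWm (k + 1 + j)) hsplit (indepFun_tail hWm hW k)).comp
      hg measurable_id

theorem indepFun_of_recursion (hWm : ∀ k, Measurable (W k)) (hW : iIndepFun W Pr)
    (hg : Measurable g) (hX₀ : Measurable (X 0)) (hX₀W : IndepFun (X 0) (fun ω k => W k ω) Pr)
    (hX : ∀ k ω, X (k + 1) ω = g (X k ω, W k ω)) (k : ℕ) : IndepFun (X k) (W k) Pr :=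
  (indepFun_tail_of_recursion hWm hW hg hX₀ hX₀W hX k).comp measurable_id (measurable_pi_apply 0)

theorem hasLaw_of_recursion {ν : Measure 𝓦} {ρ : Measure 𝓧} (hν : ∀ k, HasLaw (W k) ν Pr)
    (hXW : ∀ k, IndepFun (X k) (W k) Pr) (hX : ∀ k ω, X (k + 1) ω = g (X k ω, W k ω))
    (hρ : HasLaw g ρ (ρ.prod ν)) (hX₀ : HasLaw (X 0) ρ Pr) (k : ℕ) : HasLaw (X k) ρ Pr := by
  induction k with
  | zero => exact hX₀
  | succ k ih =>
    rw [funext (hX k)]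
    exact hρ.fun_comp ((hXW k).hasLaw_prod ih (hν k))

end RandomRecursion

section InvariantMeasure

variable {Ω : Type*} [MeasurableSpace Ω] {Pr : Measure Ω} {n : ℕ}

theorem memLp_of_hasLaw {𝓔 : Type*} [NormedAddCommGroup 𝓔] [MeasurableSpace 𝓔]
    {X : Ω → 𝓔} {ρ : Measure 𝓔} {p : ENNReal} (hX : HasLaw X ρ Pr) (hρ : MemLp id p ρ) :
    MemLp X p Pr := by
  rw [← hX.map_eq] at hρ
  exact (memLp_map_measure_iff hρ.aestronglyMeasurable hX.aemeasurable).mp hρ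

theorem memLp_mv {a b : ℕ} (M : Matrix (Fin a) (Fin b) ℝ) {X : Ω → Vec b} {p : ENNReal}
    (hX : MemLp X p Pr) : MemLp (fun ω => mv M (X ω)) p Pr :=
  (mvL M).comp_memLp' hX

theorem charFun_map_mv {a b : ℕ} (M : Matrix (Fin a) (Fin b) ℝ) (μ : Measure (Vec b)) (t : Vec a) :
    charFun (μ.map (mv M)) t = charFun μ (mv Mᵀ t) := by
  simp only [charFun_apply]
  rw [integral_map (by fun_prop) (by fun_prop)]
  simp only [inner_mv_left]

theorem charFun_map_mv_add {a b : ℕ} (M : Matrix (Fin a) (Fin b) ℝ) (ρ : Measure (Vec b))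
    (ν : Measure (Vec a)) [SFinite ρ] [SFinite ν] (t : Vec a) :
    charFun ((ρ.prod ν).map fun p => mv M p.1 + p.2) t
      = charFun ρ (mv Mᵀ t) * charFun ν t := by
  simp only [charFun_apply]
  rw [integral_map (by fun_prop) (by fun_prop), ← integral_prod_mul]
  refine integral_congr_ae (.of_forall fun p => ?_)
  simp only [inner_add_left, inner_mv_left, Complex.ofReal_add, add_mul, Complex.exp_add]

/-- The partial sum `∑ k < N, Mᵏ G(k)`, the state at time `N` of `X⁺ = M X + G` started at `0`
with the noise in reversed order. -/
noncomputable def partialSum {Ω : Type*} (M : Matrix (Fin n) (Fin n) ℝ) (G : ℕ → Ω → Vec n)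
    (N : ℕ) (ω : Ω) : Vec n :=
  ∑ k ∈ Finset.range N, mv (M ^ k) (G k ω)

theorem partialSum_succ {Ω : Type*} (M : Matrix (Fin n) (Fin n) ℝ) (G : ℕ → Ω → Vec n)
    (N : ℕ) (ω : Ω) :
    partialSum M G (N + 1) ω = partialSum M G N ω + mv (M ^ N) (G N ω) :=
  Finset.sum_range_succ _ _

theorem memLp_partialSum (M : Matrix (Fin n) (Fin n) ℝ) {G : ℕ → Ω → Vec n} {p : ENNReal}
    (hG : ∀ k, MemLp (G k) p Pr) (N : ℕ) : MemLp (partialSum M G N) p Pr :=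
  memLp_finsetSum _ fun k _ => memLp_mv _ (hG k)

theorem charFun_partialSum (M : Matrix (Fin n) (Fin n) ℝ)
    {G : ℕ → Ω → Vec n} {ν : Measure (Vec n)} (hG : iIndepFun G Pr)
    (hν : ∀ k, HasLaw (G k) ν Pr) (N : ℕ) (t : Vec n) :
    charFun (Pr.map (partialSum M G N)) t
      = ∏ k ∈ Finset.range N, charFun ν (mv (M ^ k)ᵀ t) := by
  have hlaw : ∀ k, HasLaw (fun ω => mv (M ^ k) (G k ω)) (ν.map (mv (M ^ k))) Pr := fun k =>
    (HasLaw.mk (by fun_prop) rfl).fun_comp (hν k)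
  unfold partialSum
  rw [iIndepFun.charFun_map_fun_finsetSum_eq_prod (fun k _ => (hlaw k).aemeasurable)
    ((hG.comp (fun k => mv (M ^ k)) fun k => measurable_mv _).restrict _), Finset.prod_apply]
  exact Finset.prod_congr rfl fun k _ =>
    (congrArg (charFun · t) (hlaw k).map_eq).trans (charFun_map_mv _ _ _)

theorem exists_tendsto_partialSum {M : Matrix (Fin n) (Fin n) ℝ} (hM : IsExponentiallyStable M)
    {G : ℕ → Ω → Vec n} {ν : Measure (Vec n)} {p : ENNReal} [Fact (1 ≤ p)]
    (hG : ∀ k, MemLp (G k) p Pr) (hν : ∀ k, HasLaw (G k) ν Pr) :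
    ∃ Y : Ω → Vec n, MemLp Y p Pr ∧ TendstoInMeasure Pr (partialSum M G) Filter.atTop Y := by
  obtain ⟨C, r, -, hr, hMr⟩ := hM
  have hcauchy : CauchySeq fun N => (memLp_partialSum M hG N).toLp (partialSum M G N) := by
    refine cauchySeq_of_le_geometric r (C * ‖(hG 0).toLp (G 0)‖) hr fun N => ?_
    have hnorm : ‖(hG N).toLp (G N)‖ = ‖(hG 0).toLp (G 0)‖ := by
      rw [Lp.norm_toLp, Lp.norm_toLp, ((hν N).identDistrib (hν 0)).eLpNorm_eq]
    rw [dist_comm, dist_eq_norm, ← MemLp.toLp_sub, ← hnorm, mul_right_comm]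
    refine Lp.norm_le_mul_norm_of_ae_le_mul ?_
    filter_upwards [((memLp_partialSum M hG (N + 1)).sub (memLp_partialSum M hG N)).coeFn_toLp,
      (hG N).coeFn_toLp] with ω hsub hGN
    rw [hsub, hGN, Pi.sub_apply, partialSum_succ, add_sub_cancel_left]
    exact hMr N _
  obtain ⟨Y, hY⟩ := cauchySeq_tendsto_of_complete hcauchy
  exact ⟨Y, Lp.memLp Y,
    (tendstoInMeasure_of_tendsto_Lp hY).congr_left fun N => MemLp.coeFn_toLp _⟩

theorem exists_tendsto_prod_charFun {M : Matrix (Fin n) (Fin n) ℝ} (hM : IsExponentiallyStable M)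
    {ν : Measure (Vec n)} [IsProbabilityMeasure ν] {p : ENNReal} [Fact (1 ≤ p)]
    (hν : MemLp id p ν) :
    ∃ ρ : Measure (Vec n), IsProbabilityMeasure ρ ∧ MemLp id p ρ ∧ ∀ t, Filter.Tendsto
      (fun N => ∏ k ∈ Finset.range N, charFun ν (mv (M ^ k)ᵀ t)) Filter.atTop
      (nhds (charFun ρ t)) := by
  obtain ⟨Ω, _, Pr, G, -, hlaw, hindep, _⟩ := exists_iid ℕ ν
  have hG : ∀ k, MemLp (G k) p Pr := fun k => memLp_of_hasLaw (hlaw k) hν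
  obtain ⟨Y, hY, hlim⟩ := exists_tendsto_partialSum hM hG hlaw
  have hYm : AEMeasurable Y Pr := hY.aemeasurable
  refine ⟨Pr.map Y, Measure.isProbabilityMeasure_map hYm,
    (memLp_map_measure_iff (by fun_prop) hYm).mpr hY, fun t => ?_⟩
  have hdistr := (hlim.tendstoInDistribution
    fun N => (memLp_partialSum M hG N).aemeasurable).tendsto
  simpa only [ProbabilityMeasure.coe_mk, charFun_partialSum M hindep hlaw] using
    ProbabilityMeasure.tendsto_iff_tendsto_charFun.mp hdistr t

theorem exists_invariant_measure {M : Matrix (Fin n) (Fin n) ℝ} (hM : IsExponentiallyStable M)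
    {ν : Measure (Vec n)} [IsProbabilityMeasure ν] {p : ENNReal} [Fact (1 ≤ p)]
    (hν : MemLp id p ν) :
    ∃ ρ : Measure (Vec n), IsProbabilityMeasure ρ ∧ MemLp id p ρ ∧
      HasLaw (fun x => mv M x.1 + x.2) ρ (ρ.prod ν) := by
  obtain ⟨ρ, hρ, hρp, hlim⟩ := exists_tendsto_prod_charFun hM hν
  have hm : Measurable fun x : Vec n × Vec n => mv M x.1 + x.2 := by fun_prop
  have := Measure.isProbabilityMeasure_map (μ := ρ.prod ν) hm.aemeasurable
  refine ⟨ρ, hρ, hρp, hm.aemeasurable, Measure.ext_of_charFun (funext fun t => ?_)⟩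
  rw [charFun_map_mv_add]
  refine tendsto_nhds_unique ((hlim (mv Mᵀ t)).mul_const _)
    (((Filter.tendsto_add_atTop_iff_nat 1).mpr (hlim t)).congr fun N => ?_)
  simp only [Finset.prod_range_succ', pow_zero, Matrix.transpose_one, one_mv, pow_succ',
    Matrix.transpose_mul, mul_mv]

theorem exists_invariant_measure_comp {𝓦 : Type*} [MeasurableSpace 𝓦]
    {M : Matrix (Fin n) (Fin n) ℝ} (hM : IsExponentiallyStable M)
    {ν : Measure 𝓦} [IsProbabilityMeasure ν] {g : 𝓦 → Vec n} (hgm : Measurable g)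
    {p : ENNReal} [Fact (1 ≤ p)] (hg : MemLp g p ν) :
    ∃ ρ : Measure (Vec n), IsProbabilityMeasure ρ ∧ MemLp id p ρ ∧
      HasLaw (fun x => mv M x.1 + g x.2) ρ (ρ.prod ν) := by
  have := Measure.isProbabilityMeasure_map (μ := ν) hgm.aemeasurable
  have hmap : MemLp id p (ν.map g) := (memLp_map_measure_iff (by fun_prop) hgm.aemeasurable).mpr hg
  obtain ⟨ρ, hρ, hρp, hinv⟩ := exists_invariant_measure hM hmap
  have hprod : MeasurePreserving (Prod.map id g) (ρ.prod ν) (ρ.prod (ν.map g)) :=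
    (MeasurePreserving.id ρ).prod (hgm.measurePreserving ν)
  have hlaw := hinv.comp hprod.hasLaw
  exact ⟨ρ, hρ, hρp, hlaw⟩

theorem exists_hasLaw_of_uniform {𝓦 𝓧 : Type*} [MeasurableSpace 𝓦] [MeasurableSpace 𝓧]
    [StandardBorelSpace 𝓧] [Nonempty 𝓧] (ρ : Measure 𝓧) [IsProbabilityMeasure ρ] {W : Ω → 𝓦}
    {ξ : Ω → unitInterval} (hξ : Measurable ξ) (hlaw : HasLaw ξ volume Pr)
    (hind : IndepFun ξ W Pr) : ∃ X : Ω → 𝓧, Measurable X ∧ HasLaw X ρ Pr ∧ IndepFun X W Pr := by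
  obtain ⟨g, hg, hgρ⟩ := ρ.exists_measurable_map_eq
  exact ⟨g ∘ ξ, hg.comp hξ, (HasLaw.mk hg.aemeasurable hgρ).comp hlaw,
    hind.comp hg measurable_id⟩

end InvariantMeasure

section SquareIntegrable

variable {Ω 𝓗 : Type*} [MeasurableSpace Ω] {Pr : Measure Ω} [NormedAddCommGroup 𝓗]
  [InnerProductSpace ℝ 𝓗] {X Y Z : Ω → 𝓗}

theorem integrable_inner_of_memLp (hX : MemLp X 2 Pr) (hY : MemLp Y 2 Pr) :
    Integrable (fun ω => inner ℝ (X ω) (Y ω)) Pr :=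
  memLp_one_iff_integrable.mp ((innerSL ℝ).memLp_of_bilin 1 hX hY)

theorem integral_inner_add_left (hX : MemLp X 2 Pr) (hY : MemLp Y 2 Pr) (hZ : MemLp Z 2 Pr) :
    ∫ ω, inner ℝ (X ω + Y ω) (Z ω) ∂Pr
      = ∫ ω, inner ℝ (X ω) (Z ω) ∂Pr + ∫ ω, inner ℝ (Y ω) (Z ω) ∂Pr := by
  simp only [inner_add_left]
  exact integral_add (integrable_inner_of_memLp hX hZ) (integrable_inner_of_memLp hY hZ)

theorem integral_inner_sub_left (hX : MemLp X 2 Pr) (hY : MemLp Y 2 Pr) (hZ : MemLp Z 2 Pr) :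
    ∫ ω, inner ℝ (X ω - Y ω) (Z ω) ∂Pr
      = ∫ ω, inner ℝ (X ω) (Z ω) ∂Pr - ∫ ω, inner ℝ (Y ω) (Z ω) ∂Pr := by
  simp only [inner_sub_left]
  exact integral_sub (integrable_inner_of_memLp hX hZ) (integrable_inner_of_memLp hY hZ)

theorem integral_inner_add_right (hX : MemLp X 2 Pr) (hY : MemLp Y 2 Pr) (hZ : MemLp Z 2 Pr) :
    ∫ ω, inner ℝ (X ω) (Y ω + Z ω) ∂Pr
      = ∫ ω, inner ℝ (X ω) (Y ω) ∂Pr + ∫ ω, inner ℝ (X ω) (Z ω) ∂Pr := by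
  simp only [inner_add_right]
  exact integral_add (integrable_inner_of_memLp hX hY) (integrable_inner_of_memLp hX hZ)

theorem norm_toLp_sq (hX : MemLp X 2 Pr) : ‖hX.toLp X‖ ^ 2 = ∫ ω, ‖X ω‖ ^ 2 ∂Pr := by
  rw [← real_inner_self_eq_norm_sq, L2.inner_def]
  refine integral_congr_ae ?_
  filter_upwards [hX.coeFn_toLp] with ω hω
  rw [hω, real_inner_self_eq_norm_sq]

theorem sq_abs_sqrt_integral_norm_sq_sub_le (hX : MemLp X 2 Pr) (hY : MemLp Y 2 Pr) :
    |√(∫ ω, ‖X ω‖ ^ 2 ∂Pr) - √(∫ ω, ‖Y ω‖ ^ 2 ∂Pr)| ^ 2 ≤ ∫ ω, ‖X ω - Y ω‖ ^ 2 ∂Pr := by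
  have htri := abs_norm_sub_norm_le (hX.toLp X) (hY.toLp Y)
  rw [← MemLp.toLp_sub] at htri
  calc _ = |‖hX.toLp X‖ - ‖hY.toLp Y‖| ^ 2 := by
        rw [← norm_toLp_sq hX, ← norm_toLp_sq hY, Real.sqrt_sq (norm_nonneg _),
          Real.sqrt_sq (norm_nonneg _)]
    _ ≤ ‖(hX.sub hY).toLp (X - Y)‖ ^ 2 := by gcongr
    _ = _ := norm_toLp_sq (hX.sub hY)

variable [CompleteSpace 𝓗]

theorem integral_inner_of_indepFun [IsFiniteMeasure Pr] [MeasurableSpace 𝓗] [BorelSpace 𝓗]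
    (hX : MemLp X 2 Pr) (hY : MemLp Y 2 Pr) (hXY : IndepFun X Y Pr) :
    ∫ ω, inner ℝ (X ω) (Y ω) ∂Pr = inner ℝ (∫ ω, X ω ∂Pr) (∫ ω, Y ω ∂Pr) :=
  hXY.integral_bilin (hX.integrable one_le_two) (hY.integrable one_le_two) (innerSL ℝ)

variable [IsProbabilityMeasure Pr]

theorem integral_sub_integral (hX : Integrable X Pr) : ∫ ω, (X ω - ∫ ω', X ω' ∂Pr) ∂Pr = 0 := by
  simp [integral_sub hX (integrable_const _)]

theorem integral_norm_sq_eq (hX : MemLp X 2 Pr) :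
    ∫ ω, ‖X ω‖ ^ 2 ∂Pr
      = ‖∫ ω, X ω ∂Pr‖ ^ 2 + ∫ ω, ‖X ω - ∫ ω', X ω' ∂Pr‖ ^ 2 ∂Pr := by
  have hXi : Integrable X Pr := hX.integrable one_le_two
  have hXc : MemLp (fun ω => X ω - ∫ ω', X ω' ∂Pr) 2 Pr := hX.sub (memLp_const _)
  have hcross : ∫ ω, inner ℝ (∫ ω', X ω' ∂Pr) (X ω - ∫ ω', X ω' ∂Pr) ∂Pr = 0 := by
    rw [integral_inner (hXc.integrable one_le_two), integral_sub_integral hXi, inner_zero_right]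
  have hpyth : ∀ ω, ‖X ω‖ ^ 2 = ‖∫ ω', X ω' ∂Pr‖ ^ 2
      + 2 * inner ℝ (∫ ω', X ω' ∂Pr) (X ω - ∫ ω', X ω' ∂Pr) + ‖X ω - ∫ ω', X ω' ∂Pr‖ ^ 2 :=
    fun ω => by rw [← norm_add_sq_real, add_sub_cancel]
  have hcross_int := (integrable_inner_of_memLp (memLp_const (∫ ω', X ω' ∂Pr)) hXc).const_mul 2
  simp only [hpyth]
  rw [integral_add ((integrable_const _).fun_add hcross_int) (hXc.integrable_norm_pow two_ne_zero),
    integral_add (integrable_const _) hcross_int, integral_const_mul, hcross]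
  simp

theorem norm_integral_sub_integral_sq_le (hX : MemLp X 2 Pr) (hY : MemLp Y 2 Pr) :
    ‖(∫ ω, X ω ∂Pr) - ∫ ω, Y ω ∂Pr‖ ^ 2 ≤ ∫ ω, ‖X ω - Y ω‖ ^ 2 ∂Pr := by
  have hXY : MemLp (fun ω => X ω - Y ω) 2 Pr := hX.sub hY
  rw [← integral_sub (hX.integrable one_le_two) (hY.integrable one_le_two),
    integral_norm_sq_eq hXY]
  exact le_add_of_nonneg_right (integral_nonneg fun ω => by positivity)

end SquareIntegrable

section MeanVariance

variable {Ω : Type*} [MeasurableSpace Ω] {Pr : Measure Ω} {a b d : ℕ}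

theorem integral_mv (M : Matrix (Fin a) (Fin b) ℝ) {X : Ω → Vec b} (hX : Integrable X Pr) :
    ∫ ω, mv M (X ω) ∂Pr = mv M (∫ ω, X ω ∂Pr) :=
  (mvL M).integral_comp_comm hX

theorem integral_mv_add_mv (M : Matrix (Fin a) (Fin b) ℝ) (N : Matrix (Fin a) (Fin d) ℝ)
    {X : Ω → Vec b} {Y : Ω → Vec d} (hX : Integrable X Pr) (hY : Integrable Y Pr) :
    ∫ ω, (mv M (X ω) + mv N (Y ω)) ∂Pr = mv M (∫ ω, X ω ∂Pr) + mv N (∫ ω, Y ω ∂Pr) := by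
  rw [← integral_mv M hX, ← integral_mv N hY]
  exact integral_add ((mvL M).integrable_comp hX) ((mvL N).integrable_comp hY)

variable {M : Matrix (Fin d) (Fin d) ℝ} {X Y : Ω → Vec d}

theorem integrable_qf (M : Matrix (Fin d) (Fin d) ℝ) (hX : MemLp X 2 Pr) :
    Integrable (fun ω => qf M (X ω)) Pr :=
  integrable_inner_of_memLp hX (memLp_mv M hX)

theorem integral_qf_add (hM : M.IsHermitian) (hX : MemLp X 2 Pr) (hY : MemLp Y 2 Pr) :
    ∫ ω, qf M (X ω + Y ω) ∂Pr
      = ∫ ω, qf M (X ω) ∂Pr + 2 * ∫ ω, inner ℝ (X ω) (mv M (Y ω)) ∂Pr + ∫ ω, qf M (Y ω) ∂Pr := by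
  have hXY := (integrable_inner_of_memLp hX (memLp_mv M hY)).const_mul 2
  simp only [qf_add_right hM]
  rw [integral_add ((integrable_qf M hX).fun_add hXY) (integrable_qf M hY),
    integral_add (integrable_qf M hX) hXY, integral_const_mul]

variable [IsProbabilityMeasure Pr]

theorem trace_mul_covMat (M : Matrix (Fin d) (Fin d) ℝ) (hX : MemLp X 2 Pr) :
    (M * covMat Pr X).trace = ∫ ω, qf M (X ω - ∫ ω', X ω' ∂Pr) ∂Pr := by
  set Z : Ω → Vec d := fun ω => X ω - ∫ ω', X ω' ∂Pr
  have hmean : ∀ i, (∫ ω, X ω ∂Pr) i = ∫ ω, X ω i ∂Pr :=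
    eval_integral_piLp fun i => (hX.eval_piLp i).integrable one_le_two
  have hZ : ∀ i, MemLp (fun ω => Z ω i) 2 Pr := (hX.sub (memLp_const _)).eval_piLp
  have hint : ∀ i j, Integrable (fun ω => M i j * (Z ω j * Z ω i)) Pr :=
    fun i j => ((hZ j).integrable_mul (hZ i)).const_mul _
  have hqf : ∀ ω, qf M (Z ω) = ∑ i, ∑ j, M i j * (Z ω j * Z ω i) := fun ω => by
    simp only [qf, PiLp.inner_apply, mv_apply, RCLike.inner_apply, conj_trivial, Finset.sum_mul,
      mul_assoc]
  calc (M * covMat Pr X).trace = ∑ i, ∑ j, M i j * ∫ ω, Z ω j * Z ω i ∂Pr := by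
        simp only [Matrix.trace, Matrix.diag_apply, Matrix.mul_apply, covMat, Matrix.of_apply,
          covariance, Z, PiLp.sub_apply, hmean]
    _ = ∑ i, ∑ j, ∫ ω, M i j * (Z ω j * Z ω i) ∂Pr := by simp only [integral_const_mul]
    _ = ∫ ω, qf M (Z ω) ∂Pr := by
        simp only [hqf]
        rw [integral_finsetSum _ fun i _ => integrable_finsetSum _ fun j _ => hint i j]
        exact Finset.sum_congr rfl fun i _ => (integral_finsetSum _ fun j _ => hint i j).symm

theorem trace_covMat (hX : MemLp X 2 Pr) :
    (covMat Pr X).trace = ∫ ω, ‖X ω - ∫ ω', X ω' ∂Pr‖ ^ 2 ∂Pr := by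
  rw [← one_mul (covMat Pr X), trace_mul_covMat 1 hX]
  simp only [qf_one]

theorem sq_abs_sqrt_trace_covMat_sub_le (hX : MemLp X 2 Pr) (hY : MemLp Y 2 Pr) :
    |√((covMat Pr X).trace) - √((covMat Pr Y).trace)| ^ 2 ≤ ∫ ω, ‖X ω - Y ω‖ ^ 2 ∂Pr := by
  have hcentred : ∀ ω, X ω - ∫ ω', X ω' ∂Pr - (Y ω - ∫ ω', Y ω' ∂Pr)
      = X ω - Y ω - ∫ ω', (X ω' - Y ω') ∂Pr := fun ω => by
    rw [integral_sub (hX.integrable one_le_two) (hY.integrable one_le_two)]; abel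
  have hXY : MemLp (fun ω => X ω - Y ω) 2 Pr := hX.sub hY
  have hXc : MemLp (fun ω => X ω - ∫ ω', X ω' ∂Pr) 2 Pr := hX.sub (memLp_const _)
  have hYc : MemLp (fun ω => Y ω - ∫ ω', Y ω' ∂Pr) 2 Pr := hY.sub (memLp_const _)
  rw [trace_covMat hX, trace_covMat hY, integral_norm_sq_eq hXY]
  refine (sq_abs_sqrt_integral_norm_sq_sub_le hXc hYc).trans ?_
  simp only [hcentred]
  exact le_add_of_nonneg_left (by positivity)

/-- The contribution of a single random vector to the stage cost: the quadratic and linear cost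
`E[Xᵀ Q₁ X + sᵀ X]` plus the variance penalty `tr (Q₂ Cov X)`. -/
noncomputable def meanVarianceCost (Pr : Measure Ω) (Q₁ Q₂ : Matrix (Fin d) (Fin d) ℝ) (s : Vec d)
    (X : Ω → Vec d) : ℝ :=
  ∫ ω, (qf Q₁ (X ω) + inner ℝ s (X ω)) ∂Pr + (Q₂ * covMat Pr X).trace

theorem trace_mul_covMat_add (hM : M.IsHermitian) (hX : MemLp X 2 Pr) (hY : MemLp Y 2 Pr) :
    (M * covMat Pr (fun ω => X ω + Y ω)).trace = (M * covMat Pr X).trace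
      + 2 * ∫ ω, inner ℝ (X ω) (mv M (Y ω - ∫ ω', Y ω' ∂Pr)) ∂Pr + (M * covMat Pr Y).trace := by
  have hXi := hX.integrable one_le_two
  have hYi := hY.integrable one_le_two
  have hXc : MemLp (fun ω => X ω - ∫ ω', X ω' ∂Pr) 2 Pr := hX.sub (memLp_const _)
  have hYc : MemLp (fun ω => Y ω - ∫ ω', Y ω' ∂Pr) 2 Pr := hY.sub (memLp_const _)
  have hcentred : ∀ ω, X ω + Y ω - ∫ ω', (X ω' + Y ω') ∂Pr
      = (X ω - ∫ ω', X ω' ∂Pr) + (Y ω - ∫ ω', Y ω' ∂Pr) := fun ω => by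
    rw [integral_add hXi hYi]; abel
  have hcross : ∫ ω, inner ℝ (∫ ω', X ω' ∂Pr) (mv M (Y ω - ∫ ω', Y ω' ∂Pr)) ∂Pr = 0 := by
    rw [integral_inner ((memLp_mv M hYc).integrable one_le_two),
      integral_mv M (hYc.integrable one_le_two), integral_sub_integral hYi, mv_zero,
      inner_zero_right]
  have hXY : MemLp (fun ω => X ω + Y ω) 2 Pr := hX.add hY
  rw [trace_mul_covMat M hXY, trace_mul_covMat M hX, trace_mul_covMat M hY]
  simp only [hcentred]
  rw [integral_qf_add hM hXc hYc, integral_inner_sub_left hX (memLp_const _) (memLp_mv M hYc),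
    hcross, sub_zero]

theorem meanVarianceCost_eq (Q₁ Q₂ : Matrix (Fin d) (Fin d) ℝ) (s : Vec d) (hX : MemLp X 2 Pr) :
    meanVarianceCost Pr Q₁ Q₂ s X
      = ∫ ω, qf Q₁ (X ω) ∂Pr + inner ℝ s (∫ ω, X ω ∂Pr) + (Q₂ * covMat Pr X).trace := by
  have hXi := hX.integrable one_le_two
  rw [meanVarianceCost, integral_add (integrable_qf Q₁ hX) (hXi.const_inner s),
    integral_inner hXi]

/-- The part that is linear in `X` splits into a centred part, weighted by `Q₁ + Q₂`, and a part
that depends on the means only. -/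
theorem meanVarianceCost_add {Q₁ Q₂ : Matrix (Fin d) (Fin d) ℝ} (hQ₁ : Q₁.IsHermitian)
    (hQ₂ : Q₂.IsHermitian) (s : Vec d) (hX : MemLp X 2 Pr) (hY : MemLp Y 2 Pr) {y : Vec d}
    (hy : ∫ ω, Y ω ∂Pr = y) :
    meanVarianceCost Pr Q₁ Q₂ s (fun ω => X ω + Y ω)
      = meanVarianceCost Pr Q₁ Q₂ s Y + ∫ ω, qf Q₁ (X ω) ∂Pr + (Q₂ * covMat Pr X).trace
        + 2 * ∫ ω, inner ℝ (X ω) (mv (Q₁ + Q₂) (Y ω - y)) ∂Pr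
        + (2 * inner ℝ (∫ ω, X ω ∂Pr) (mv Q₁ y) + inner ℝ s (∫ ω, X ω ∂Pr)) := by
  have hXi := hX.integrable one_le_two
  have hXY : MemLp (fun ω => X ω + Y ω) 2 Pr := hX.add hY
  have hYc : MemLp (fun ω => Y ω - y) 2 Pr := hY.sub (memLp_const _)
  have hsum : ∫ ω, inner ℝ (X ω) (mv (Q₁ + Q₂) (Y ω - y)) ∂Pr
      = ∫ ω, inner ℝ (X ω) (mv Q₁ (Y ω - y)) ∂Pr
        + ∫ ω, inner ℝ (X ω) (mv Q₂ (Y ω - y)) ∂Pr := by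
    simp only [add_mv]
    exact integral_inner_add_right hX (memLp_mv Q₁ hYc) (memLp_mv Q₂ hYc)
  have hmean : ∫ ω, inner ℝ (X ω) (mv Q₁ (Y ω)) ∂Pr
      = ∫ ω, inner ℝ (X ω) (mv Q₁ (Y ω - y)) ∂Pr + inner ℝ (∫ ω, X ω ∂Pr) (mv Q₁ y) := by
    have hsplit := integral_inner_add_right hX (memLp_mv Q₁ hYc) (memLp_const (mv Q₁ y))
    simp only [← mv_add, sub_add_cancel] at hsplit
    rw [hsplit, real_inner_comm, ← integral_inner hXi]
    simp only [real_inner_comm]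
  rw [meanVarianceCost_eq Q₁ Q₂ s hXY, meanVarianceCost_eq Q₁ Q₂ s hY,
    integral_qf_add hQ₁ hX hY, trace_mul_covMat_add hQ₂ hX hY,
    integral_add hXi (hY.integrable one_le_two), inner_add_right, hy, hsum, hmean]
  ring

theorem le_meanVarianceCost_sub {Q₁ Q₂ : Matrix (Fin d) (Fin d) ℝ} (hQ₁ : Q₁.IsHermitian)
    (hQ₂ : Q₂.PosSemidef) (s : Vec d) (hX : MemLp X 2 Pr) (hY : MemLp Y 2 Pr) {y : Vec d}
    (hy : ∫ ω, Y ω ∂Pr = y) :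
    ∫ ω, qf Q₁ (X ω - Y ω) ∂Pr + 2 * ∫ ω, inner ℝ (X ω - Y ω) (mv (Q₁ + Q₂) (Y ω - y)) ∂Pr
        + (2 * inner ℝ (∫ ω, (X ω - Y ω) ∂Pr) (mv Q₁ y) + inner ℝ s (∫ ω, (X ω - Y ω) ∂Pr))
      ≤ meanVarianceCost Pr Q₁ Q₂ s X - meanVarianceCost Pr Q₁ Q₂ s Y := by
  have hXY : MemLp (fun ω => X ω - Y ω) 2 Pr := hX.sub hY
  have hvar : 0 ≤ (Q₂ * covMat Pr fun ω => X ω - Y ω).trace := by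
    rw [trace_mul_covMat Q₂ hXY]
    exact integral_nonneg fun ω => qf_nonneg hQ₂ _
  have hadd := meanVarianceCost_add hQ₁ hQ₂.isHermitian s hXY hY hy
  simp only [sub_add_cancel] at hadd
  linarith

end MeanVariance

section CostDifference

variable {n l m : ℕ} {D : Data n l m} {P : Matrix (Fin n) (Fin n) ℝ} {x q : Vec n} {u : Vec l}

theorem Data.f_sub_f (D : Data n l m) (x x' : Vec n) (u u' : Vec l) (w : Vec m) :
    D.f x u w - D.f x' u' w = mv D.A (x - x') + mv D.B (u - u') := by
  simp only [Data.f, mv_sub]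
  abel

theorem Data.IsSteadyState.f_sub {μ : Vec m} (hs : D.IsSteadyState μ x u) (y : Vec n) (u' : Vec l)
    (w : Vec m) :
    D.f y u' w - x = mv D.A (y - x) + mv D.B (u' - u) + mv D.E (w - μ) := by
  have hz : D.z = x - mv D.A x - mv D.B u - mv D.E μ := eq_sub_of_add_eq' hs.symm
  simp only [Data.f, mv_sub, hz]
  abel

theorem Data.IsRiccatiSolution.inner_add_inner (hR : (D.R₁ + D.R₂).PosDef)
    (hP : D.IsRiccatiSolution P) (d z : Vec n) (w : Vec l) :
    inner ℝ d (mv (D.Q₁ + D.Q₂) z) + inner ℝ w (mv (D.R₁ + D.R₂) (mv (D.gain P) z))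
      = inner ℝ d (mv P z) - inner ℝ (mv D.A d + mv D.B w) (mv P (mv (D.closedLoop P) z)) := by
  have hstate : mv P z = mv (D.Q₁ + D.Q₂) z + mv D.Aᵀ (mv P (mv (D.closedLoop P) z)) := by
    rw [← mul_mv, ← mul_mv, ← add_mv, ← riccatiMap_eq]
    exact congrArg (mv · z) hP.2
  have hinput := inner_inputWeight_gain hR hP.1 z w
  rw [inner_add_left, hstate, inner_add_right, ← inner_mv_left]
  linarith

variable {Ω : Type*} [MeasurableSpace Ω] {Pr : Measure Ω} {X Y : Ω → Vec n} {U U' : Ω → Vec l}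

theorem Data.IsRiccatiSolution.integral_inner_add_integral_inner (hR : (D.R₁ + D.R₂).PosDef)
    (hP : D.IsRiccatiSolution P) {d Z : Ω → Vec n} {w : Ω → Vec l} (hd : MemLp d 2 Pr)
    (hw : MemLp w 2 Pr) (hZ : MemLp Z 2 Pr) :
    ∫ ω, inner ℝ (d ω) (mv (D.Q₁ + D.Q₂) (Z ω)) ∂Pr
        + ∫ ω, inner ℝ (w ω) (mv (D.R₁ + D.R₂) (mv (D.gain P) (Z ω))) ∂Pr
      = ∫ ω, inner ℝ (d ω) (mv P (Z ω)) ∂Pr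
        - ∫ ω, inner ℝ (mv D.A (d ω) + mv D.B (w ω)) (mv P (mv (D.closedLoop P) (Z ω))) ∂Pr := by
  have hd' : MemLp (fun ω => mv D.A (d ω) + mv D.B (w ω)) 2 Pr :=
    (memLp_mv D.A hd).add (memLp_mv D.B hw)
  rw [← integral_add (integrable_inner_of_memLp hd (memLp_mv _ hZ))
      (integrable_inner_of_memLp hw (memLp_mv _ (memLp_mv _ hZ))),
    ← integral_sub (integrable_inner_of_memLp hd (memLp_mv P hZ))
      (integrable_inner_of_memLp hd' (memLp_mv P (memLp_mv _ hZ)))]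
  simp only [hP.inner_add_inner hR]

variable [IsProbabilityMeasure Pr]

theorem Data.memLp_f (D : Data n l m) {W : Ω → Vec m} (hX : MemLp X 2 Pr) (hU : MemLp U 2 Pr)
    (hW : MemLp W 2 Pr) : MemLp (fun ω => D.f (X ω) (U ω) (W ω)) 2 Pr :=
  (((memLp_mv _ hX).add (memLp_mv _ hU)).add (memLp_mv _ hW)).add (memLp_const _)

theorem Data.cost_eq (D : Data n l m) (hX : MemLp X 2 Pr) (hU : MemLp U 2 Pr) :
    D.cost Pr X U
      = meanVarianceCost Pr D.Q₁ D.Q₂ D.s X + meanVarianceCost Pr D.R₁ D.R₂ D.v U + D.c := by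
  have hXi := (integrable_qf D.Q₁ hX).fun_add ((hX.integrable one_le_two).const_inner D.s)
  have hUi := (integrable_qf D.R₁ hU).fun_add ((hU.integrable one_le_two).const_inner D.v)
  have hsplit : ∀ ω, qf D.Q₁ (X ω) + qf D.R₁ (U ω) + inner ℝ D.s (X ω) + inner ℝ D.v (U ω) + D.c
      = qf D.Q₁ (X ω) + inner ℝ D.s (X ω) + (qf D.R₁ (U ω) + inner ℝ D.v (U ω)) + D.c :=
    fun ω => by ring
  rw [Data.cost, meanVarianceCost, meanVarianceCost]
  simp only [hsplit]
  rw [integral_add (hXi.fun_add hUi) (integrable_const _), integral_add hXi hUi]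
  simp only [integral_const, probReal_univ, one_smul]
  ring

theorem integral_mv_sub_add {a : ℕ} (M : Matrix (Fin a) (Fin n) ℝ) (hY : Integrable Y Pr)
    (hYx : ∫ ω, Y ω ∂Pr = x) (w : Vec a) : ∫ ω, (mv M (Y ω - x) + w) ∂Pr = w := by
  subst hYx
  have hYc : Integrable (fun ω => Y ω - ∫ ω', Y ω' ∂Pr) Pr := hY.sub (integrable_const _)
  calc ∫ ω, (mv M (Y ω - ∫ ω', Y ω' ∂Pr) + w) ∂Pr
      = ∫ ω, mv M (Y ω - ∫ ω', Y ω' ∂Pr) ∂Pr + ∫ _, w ∂Pr :=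
        integral_add ((mvL M).integrable_comp hYc) (integrable_const w)
    _ = w := by
      rw [integral_mv M hYc, integral_sub_integral hY, mv_zero, integral_const, probReal_univ,
        one_smul, zero_add]

/-- The linear terms cancel against the multiplier (on means) and the Riccati matrix (on centred
parts), up to a telescoping remainder. -/
theorem Data.IsRiccatiSolution.le_cost_sub (hQ₁ : D.Q₁.PosSemidef) (hQ₂ : D.Q₂.PosSemidef)
    (hR₁ : D.R₁.PosDef) (hR₂ : D.R₂.PosSemidef) (hP : D.IsRiccatiSolution P)
    (hq : D.IsKKTPoint x u q) (hX : MemLp X 2 Pr) (hU : MemLp U 2 Pr) (hY : MemLp Y 2 Pr)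
    (hYx : ∫ ω, Y ω ∂Pr = x) (hU' : ∀ ω, U' ω = mv (D.gain P) (Y ω - x) + u) :
    ∫ ω, qf D.Q₁ (X ω - Y ω) ∂Pr + ∫ ω, qf D.R₁ (U ω - U' ω) ∂Pr
        + 2 * (∫ ω, inner ℝ (X ω - Y ω) (mv P (Y ω - x)) ∂Pr
          - ∫ ω, inner ℝ (mv D.A (X ω - Y ω) + mv D.B (U ω - U' ω))
              (mv P (mv (D.closedLoop P) (Y ω - x))) ∂Pr)
        - inner ℝ q (∫ ω, (X ω - Y ω) ∂Pr
          - ∫ ω, (mv D.A (X ω - Y ω) + mv D.B (U ω - U' ω)) ∂Pr)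
      ≤ D.cost Pr X U - D.cost Pr Y U' := by
  have hZ : MemLp (fun ω => Y ω - x) 2 Pr := hY.sub (memLp_const _)
  have hU'2 : MemLp U' 2 Pr := by
    rw [funext hU']
    exact (memLp_mv _ hZ).add (memLp_const _)
  have hU'u : ∫ ω, U' ω ∂Pr = u := by
    rw [funext hU']
    exact integral_mv_sub_add (D.gain P) (hY.integrable one_le_two) hYx u
  have hd : MemLp (fun ω => X ω - Y ω) 2 Pr := hX.sub hY
  have hw : MemLp (fun ω => U ω - U' ω) 2 Pr := hU.sub hU'2
  have hmean := integral_mv_add_mv D.A D.B (hd.integrable one_le_two) (hw.integrable one_le_two)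
  have hric := hP.integral_inner_add_integral_inner (hR₁.add_posSemidef hR₂) hd hw hZ
  have hlag := hq (∫ ω, (X ω - Y ω) ∂Pr) (∫ ω, (U ω - U' ω) ∂Pr)
  have hstate := le_meanVarianceCost_sub hQ₁.isHermitian hQ₂ D.s hX hY hYx
  have hinput := le_meanVarianceCost_sub hR₁.isHermitian hR₂ D.v hU hU'2 hU'u
  simp only [hU', add_sub_cancel_right] at hinput hric hlag hmean ⊢
  rw [D.cost_eq hX hU, D.cost_eq hY (by simpa only [funext hU'] using hU'2), hmean]
  linarith

end CostDifference

section Dissipation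

variable {n l m : ℕ} {D : Data n l m} {P S : Matrix (Fin n) (Fin n) ℝ} {x q : Vec n} {u : Vec l}
  {Ω : Type*} [MeasurableSpace Ω] {Pr : Measure Ω}

/-- The storage of a state `X` relative to a reference `Y` with mean `x`, in terms of the deviation
`X - Y`; up to a term in `Y` alone it is the storage function of the problem. -/
noncomputable def deviationStorage (Pr : Measure Ω) (P S : Matrix (Fin n) (Fin n) ℝ) (q x : Vec n)
    (X Y : Ω → Vec n) : ℝ :=
  ∫ ω, (qf S (X ω - Y ω) + inner ℝ (q - (2 : ℝ) • mv P (Y ω - x)) (X ω - Y ω)) ∂Pr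

/-- The part of the integrand of the storage function which depends only on the reference state. -/
noncomputable def storageOffset (P S : Matrix (Fin n) (Fin n) ℝ) (q x xt y : Vec n) : ℝ :=
  inner ℝ q xt - qf S xt - 2 * inner ℝ xt (mv P (y - x)) - qf P (y - x)

@[fun_prop]
theorem measurable_storageOffset (P S : Matrix (Fin n) (Fin n) ℝ) (q x xt : Vec n) :
    Measurable (storageOffset P S q x xt) := by
  unfold storageOffset
  fun_prop

theorem storage_integrand_eq (hP : P.IsHermitian) (hS : S.IsHermitian) (q x xt y y' : Vec n) :
    qf (P + S) (y - (y' - xt)) - qf P (y - (x - xt))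
        + inner ℝ (q - (2 : ℝ) • mv S xt) (y - (y' - xt))
      = qf S (y - y') + inner ℝ (q - (2 : ℝ) • mv P (y' - x)) (y - y')
        + storageOffset P S q x xt y' := by
  have hshift : y - (y' - xt) = y - y' + xt := by abel
  have hsplit : y - (x - xt) = (y - y' + xt) + (y' - x) := by abel
  rw [hshift, hsplit, qf_add_left, qf_add_right hP _ (y' - x), qf_add_right hS _ xt, storageOffset]
  simp only [inner_add_left, inner_add_right, inner_sub_left, real_inner_smul_left,
    real_inner_comm (y - y') (mv P _), real_inner_comm (y - y') (mv S _),
    real_inner_comm xt (mv S _)]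
  simp only [qf]
  ring

variable {X Y : Ω → Vec n} {U U' : Ω → Vec l} {W : Ω → Vec m}

theorem Data.IsStorageMatrix.mul_integral_norm_sq_le {c : ℝ} (hS : D.IsStorageMatrix S c)
    (hX : MemLp X 2 Pr) (hU : MemLp U 2 Pr) :
    c * ∫ ω, ‖X ω‖ ^ 2 ∂Pr
      ≤ ∫ ω, qf D.Q₁ (X ω) ∂Pr + ∫ ω, qf D.R₁ (U ω) ∂Pr + ∫ ω, qf S (X ω) ∂Pr
        - ∫ ω, qf S (mv D.A (X ω) + mv D.B (U ω)) ∂Pr := by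
  have hQR := (integrable_qf D.Q₁ hX).fun_add (integrable_qf D.R₁ hU)
  have hQRS := hQR.fun_add (integrable_qf S hX)
  have hnext : Integrable (fun ω => qf S (mv D.A (X ω) + mv D.B (U ω))) Pr :=
    integrable_qf S ((memLp_mv D.A hX).add (memLp_mv D.B hU))
  rw [← integral_const_mul, ← integral_add (integrable_qf _ hX) (integrable_qf _ hU),
    ← integral_add hQR (integrable_qf S hX), ← integral_sub hQRS hnext]
  exact integral_mono ((hX.integrable_norm_pow two_ne_zero).const_mul c) (hQRS.sub hnext)
    fun ω => hS.le _ _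

variable [IsProbabilityMeasure Pr]

theorem memLp_deviationStorage_slope (P : Matrix (Fin n) (Fin n) ℝ) (q x : Vec n)
    (hY : MemLp Y 2 Pr) : MemLp (fun ω => q - (2 : ℝ) • mv P (Y ω - x)) 2 Pr :=
  (memLp_const q).sub ((memLp_mv P (hY.sub (memLp_const x))).const_smul (2 : ℝ))

theorem integrable_deviationStorage (P S : Matrix (Fin n) (Fin n) ℝ) (q x : Vec n)
    (hX : MemLp X 2 Pr) (hY : MemLp Y 2 Pr) :
    Integrable (fun ω =>
      qf S (X ω - Y ω) + inner ℝ (q - (2 : ℝ) • mv P (Y ω - x)) (X ω - Y ω)) Pr :=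
  (integrable_qf S (hX.sub hY)).add
    (integrable_inner_of_memLp (memLp_deviationStorage_slope P q x hY) (hX.sub hY))

theorem integrable_storageOffset (P S : Matrix (Fin n) (Fin n) ℝ) (q x xt : Vec n)
    (hY : MemLp Y 2 Pr) : Integrable (fun ω => storageOffset P S q x xt (Y ω)) Pr := by
  have hZ : MemLp (fun ω => Y ω - x) 2 Pr := hY.sub (memLp_const x)
  exact ((integrable_const _).sub
    (((memLp_mv P hZ).integrable one_le_two).const_inner xt |>.const_mul 2)).sub
      (integrable_qf P hZ)

theorem storage_eq_deviationStorage_add (hP : P.IsHermitian) (hS : S.IsHermitian)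
    (q x xs : Vec n) {Xs : ℕ → Ω → Vec n} {k : ℕ} (hX : MemLp X 2 Pr) (hXs : MemLp (Xs k) 2 Pr) :
    storage Pr P S (q - (2 : ℝ) • mv S (x - xs)) xs (x - xs) Xs k X
      = deviationStorage Pr P S q x X (Xs k)
        + ∫ ω, storageOffset P S q x (x - xs) (Xs k ω) ∂Pr := by
  have hintegrand := storage_integrand_eq hP hS q x (x - xs)
  simp only [sub_sub_cancel] at hintegrand
  rw [storage, deviationStorage, ← integral_add (integrable_deviationStorage P S q x hX hXs)
    (integrable_storageOffset P S q x _ hXs)]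
  simp only [hintegrand]

theorem deviationStorage_eq (P S : Matrix (Fin n) (Fin n) ℝ) (q x : Vec n) (hX : MemLp X 2 Pr)
    (hY : MemLp Y 2 Pr) :
    deviationStorage Pr P S q x X Y
      = ∫ ω, qf S (X ω - Y ω) ∂Pr - 2 * ∫ ω, inner ℝ (X ω - Y ω) (mv P (Y ω - x)) ∂Pr
        + inner ℝ q (∫ ω, (X ω - Y ω) ∂Pr) := by
  have hd : MemLp (fun ω => X ω - Y ω) 2 Pr := hX.sub hY
  have hZ : MemLp (fun ω => Y ω - x) 2 Pr := hY.sub (memLp_const x)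
  have hq : Integrable (fun ω => (inner ℝ q (X ω - Y ω) : ℝ)) Pr :=
    (hd.integrable one_le_two).const_inner q
  have hcross : Integrable (fun ω => 2 * (inner ℝ (X ω - Y ω) (mv P (Y ω - x)) : ℝ)) Pr :=
    (integrable_inner_of_memLp hd (memLp_mv P hZ)).const_mul 2
  have hdiff : Integrable (fun ω =>
      (inner ℝ q (X ω - Y ω) : ℝ) - 2 * inner ℝ (X ω - Y ω) (mv P (Y ω - x))) Pr := hq.sub hcross
  have hsplit : ∀ ω, inner ℝ (q - (2 : ℝ) • mv P (Y ω - x)) (X ω - Y ω)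
      = inner ℝ q (X ω - Y ω) - 2 * inner ℝ (X ω - Y ω) (mv P (Y ω - x)) := fun ω => by
    rw [inner_sub_left, real_inner_smul_left, real_inner_comm (X ω - Y ω) (mv P _)]
  simp only [deviationStorage, hsplit]
  rw [integral_add (integrable_qf S hd) hdiff, integral_sub hq hcross,
    integral_inner (hd.integrable one_le_two), integral_const_mul]
  ring

theorem le_deviationStorage {r : ℝ} (hr : 0 < r) (hS : ∀ y, r * ‖y‖ ^ 2 ≤ qf S y)
    (P : Matrix (Fin n) (Fin n) ℝ) (q x : Vec n) (hX : MemLp X 2 Pr) (hY : MemLp Y 2 Pr) :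
    ∫ ω, -(‖q - (2 : ℝ) • mv P (Y ω - x)‖ ^ 2 / (4 * r)) ∂Pr
      ≤ deviationStorage Pr P S q x X Y :=
  integral_mono
    (((memLp_deviationStorage_slope P q x hY).integrable_norm_pow two_ne_zero).div_const _).neg
    (integrable_deviationStorage P S q x hX hY)
    fun _ => neg_norm_sq_div_le_qf_add_inner hr (hS _) _

theorem integral_inner_mv_noise {a b : ℕ} (M : Matrix (Fin n) (Fin a) ℝ)
    (N : Matrix (Fin n) (Fin b) ℝ) {V : Ω → Vec a} {W : Ω → Vec b} (hV : MemLp V 2 Pr)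
    (hW : MemLp W 2 Pr) (hVW : IndepFun V W Pr) :
    ∫ ω, inner ℝ (mv M (V ω)) (mv N (W ω - ∫ ω', W ω' ∂Pr)) ∂Pr = 0 := by
  have hWc : MemLp (fun ω => W ω - ∫ ω', W ω' ∂Pr) 2 Pr := hW.sub (memLp_const _)
  have hmeas : Measurable fun w : Vec b => mv N (w - ∫ ω, W ω ∂Pr) := by fun_prop
  rw [integral_inner_of_indepFun (memLp_mv M hV) (memLp_mv N hWc)
      (hVW.comp (measurable_mv M) hmeas),
    integral_mv N (hWc.integrable one_le_two),
    integral_sub_integral (hW.integrable one_le_two), mv_zero, inner_zero_right]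

/-- The left factor is a sum of linear terms, each in a single vector independent of `W`. -/
theorem integral_inner_deviation_noise {a : ℕ} {M : Matrix (Fin n) (Fin a) ℝ} {W : Ω → Vec a}
    {A : Matrix (Fin n) (Fin n) ℝ} {B : Matrix (Fin n) (Fin l) ℝ} (hX : MemLp X 2 Pr)
    (hY : MemLp Y 2 Pr) (hU : MemLp U 2 Pr) (hU' : MemLp U' 2 Pr) (hW : MemLp W 2 Pr)
    (hXW : IndepFun X W Pr) (hYW : IndepFun Y W Pr) (hUW : IndepFun U W Pr)
    (hU'W : IndepFun U' W Pr) :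
    ∫ ω, inner ℝ (mv A (X ω - Y ω) + mv B (U ω - U' ω)) (mv M (W ω - ∫ ω', W ω' ∂Pr)) ∂Pr
      = 0 := by
  have hN : MemLp (fun ω => mv M (W ω - ∫ ω', W ω' ∂Pr)) 2 Pr :=
    memLp_mv M (hW.sub (memLp_const _))
  have hA : MemLp (fun ω => mv A (X ω) - mv A (Y ω)) 2 Pr := (memLp_mv A hX).sub (memLp_mv A hY)
  have hB : MemLp (fun ω => mv B (U ω) - mv B (U' ω)) 2 Pr :=
    (memLp_mv B hU).sub (memLp_mv B hU')
  simp only [mv_sub A, mv_sub B]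
  rw [integral_inner_add_left hA hB hN,
    integral_inner_sub_left (memLp_mv A hX) (memLp_mv A hY) hN,
    integral_inner_sub_left (memLp_mv B hU) (memLp_mv B hU') hN,
    integral_inner_mv_noise A M hX hW hXW, integral_inner_mv_noise A M hY hW hYW,
    integral_inner_mv_noise B M hU hW hUW, integral_inner_mv_noise B M hU' hW hU'W]
  norm_num

/-- The noise does not contribute: it cancels in the difference of the two successors, and its
correlation with that difference vanishes. -/
theorem deviationStorage_f (P S : Matrix (Fin n) (Fin n) ℝ)
    (hs : D.IsSteadyState (∫ ω, W ω ∂Pr) x u) (hX : MemLp X 2 Pr) (hY : MemLp Y 2 Pr)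
    (hU : MemLp U 2 Pr) (hU' : MemLp U' 2 Pr) (hW : MemLp W 2 Pr) (hXW : IndepFun X W Pr)
    (hYW : IndepFun Y W Pr) (hUW : IndepFun U W Pr) (hU'W : IndepFun U' W Pr) :
    deviationStorage Pr P S q x (fun ω => D.f (X ω) (U ω) (W ω))
        (fun ω => D.f (Y ω) (U' ω) (W ω))
      = ∫ ω, qf S (mv D.A (X ω - Y ω) + mv D.B (U ω - U' ω)) ∂Pr
        - 2 * ∫ ω, inner ℝ (mv D.A (X ω - Y ω) + mv D.B (U ω - U' ω))
            (mv P (mv D.A (Y ω - x) + mv D.B (U' ω - u))) ∂Pr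
        + inner ℝ q (∫ ω, (mv D.A (X ω - Y ω) + mv D.B (U ω - U' ω)) ∂Pr) := by
  have hd : MemLp (fun ω => mv D.A (X ω - Y ω) + mv D.B (U ω - U' ω)) 2 Pr :=
    (memLp_mv D.A (hX.sub hY)).add (memLp_mv D.B (hU.sub hU'))
  have hZ : MemLp (fun ω => mv D.A (Y ω - x) + mv D.B (U' ω - u)) 2 Pr :=
    (memLp_mv D.A (hY.sub (memLp_const x))).add (memLp_mv D.B (hU'.sub (memLp_const u)))
  have hWc : MemLp (fun ω => W ω - ∫ ω', W ω' ∂Pr) 2 Pr := hW.sub (memLp_const _)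
  rw [deviationStorage_eq P S q x (D.memLp_f hX hU hW) (D.memLp_f hY hU' hW)]
  simp only [D.f_sub_f, hs.f_sub, mv_add P (_ + _), ← mul_mv P D.E]
  rw [integral_inner_add_right hd (memLp_mv P hZ) (memLp_mv _ hWc),
    integral_inner_deviation_noise hX hY hU hU' hW hXW hYW hUW hU'W, add_zero]

/-- One step of the dissipation inequality: the storage absorbs the telescoping remainder of the
cost difference. -/
theorem Data.IsStorageMatrix.mul_integral_norm_sub_sq_le {c : ℝ} (hS : D.IsStorageMatrix S c)
    (hQ₁ : D.Q₁.PosSemidef) (hQ₂ : D.Q₂.PosSemidef) (hR₁ : D.R₁.PosDef) (hR₂ : D.R₂.PosSemidef)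
    (hP : D.IsRiccatiSolution P) (hs : D.IsSteadyState (∫ ω, W ω ∂Pr) x u)
    (hq : D.IsKKTPoint x u q) (hX : MemLp X 2 Pr) (hU : MemLp U 2 Pr) (hY : MemLp Y 2 Pr)
    (hW : MemLp W 2 Pr) (hXW : IndepFun X W Pr) (hUW : IndepFun U W Pr) (hYW : IndepFun Y W Pr)
    (hYx : ∫ ω, Y ω ∂Pr = x) (hU' : ∀ ω, U' ω = mv (D.gain P) (Y ω - x) + u) :
    c * ∫ ω, ‖X ω - Y ω‖ ^ 2 ∂Pr ≤ D.cost Pr X U - D.cost Pr Y U'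
      + deviationStorage Pr P S q x X Y
      - deviationStorage Pr P S q x (fun ω => D.f (X ω) (U ω) (W ω))
          (fun ω => D.f (Y ω) (U' ω) (W ω)) := by
  have hU'2 : MemLp U' 2 Pr := by
    rw [funext hU']
    exact (memLp_mv _ (hY.sub (memLp_const x))).add (memLp_const u)
  have hU'W : IndepFun U' W Pr := by
    have hmeas : Measurable fun y : Vec n => mv (D.gain P) (y - x) + u := by fun_prop
    rw [funext hU']
    exact hYW.comp hmeas measurable_id
  have hcost := hP.le_cost_sub hQ₁ hQ₂ hR₁ hR₂ hq hX hU hY hYx hU'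
  have hdecay := hS.mul_integral_norm_sq_le (hX.sub hY) (hU.sub hU'2)
  rw [deviationStorage_eq P S q x hX hY,
    deviationStorage_f P S hs hX hY hU hU'2 hW hXW hYW hUW hU'W]
  have hclosed : ∀ ω, mv D.A (Y ω - x) + mv D.B (U' ω - u) = mv (D.closedLoop P) (Y ω - x) :=
    fun ω => by rw [hU', add_sub_cancel_right, closedLoop_mv]
  simp only [Pi.sub_apply] at hdecay
  simp only [hclosed]
  rw [inner_sub_right] at hcost
  linarith

end Dissipation

section Turnpike

theorem IsClassKInfty.nonneg {β : ℝ → ℝ} (hβ : IsClassKInfty β) {t : ℝ} (ht : 0 ≤ t) : 0 ≤ β t :=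
  hβ.map_zero ▸ hβ.strictMonoOn.monotoneOn Set.self_mem_Ici ht ht

theorem IsClassKInfty.pos {β : ℝ → ℝ} (hβ : IsClassKInfty β) {t : ℝ} (ht : 0 < t) : 0 < β t :=
  hβ.map_zero ▸ hβ.strictMonoOn Set.self_mem_Ici ht.le ht

theorem sub_div_le_ncard {N : ℕ} {p : ℕ → Prop} {b : ℕ → ℝ} {a T : ℝ} (ha : 0 < a)
    (hb : ∀ k < N, 0 ≤ b k) (hp : ∀ k < N, ¬p k → a ≤ b k)
    (hT : ∑ k ∈ Finset.range N, b k ≤ T) :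
    (N : ℝ) - T / a ≤ Set.ncard {k : ℕ | k < N ∧ p k} := by
  classical
  have hset : {k : ℕ | k < N ∧ p k} = ((Finset.range N).filter p : Set ℕ) := by
    ext k; simp
  have hcard : (((Finset.range N).filter p).card : ℝ)
      + ((Finset.range N).filter fun k => ¬p k).card = N := by
    exact_mod_cast (Finset.card_filter_add_card_filter_not p).trans (Finset.card_range N)
  have hbad : ((Finset.range N).filter fun k => ¬p k).card • a ≤ T := calc
    _ ≤ ∑ k ∈ (Finset.range N).filter fun k => ¬p k, b k :=
      Finset.card_nsmul_le_sum _ b a fun k hk => by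
        rw [Finset.mem_filter, Finset.mem_range] at hk
        exact hp k hk.1 hk.2
    _ ≤ ∑ k ∈ Finset.range N, b k :=
      Finset.sum_le_sum_of_subset_of_nonneg (Finset.filter_subset _ _)
        fun k hk _ => hb k (Finset.mem_range.mp hk)
    _ ≤ T := hT
  rw [nsmul_eq_mul, ← le_div_iff₀ ha] at hbad
  rw [hset, Set.ncard_coe_finset]
  linarith

theorem IsClassKInfty.sub_div_le_ncard {β : ℝ → ℝ} (hβ : IsClassKInfty β) {N : ℕ} {φ d : ℕ → ℝ}
    {T a ε : ℝ} (hd : ∀ k < N, φ k ^ 2 ≤ d k) (hT : ∑ k ∈ Finset.range N, β (d k) ≤ T)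
    (hε : 0 ≤ ε) (ha : 0 < a) (haβ : a ≤ β (ε ^ 2)) :
    (N : ℝ) - T / a ≤ Set.ncard {k : ℕ | k < N ∧ φ k ≤ ε} := by
  have hd0 : ∀ k < N, 0 ≤ d k := fun k hk => (sq_nonneg _).trans (hd k hk)
  refine StochLQ.sub_div_le_ncard ha (fun k hk => hβ.nonneg (hd0 k hk)) (fun k hk hφ => ?_) hT
  exact haβ.trans (hβ.strictMonoOn.monotoneOn (sq_nonneg ε) (hd0 k hk)
    ((pow_le_pow_left₀ hε (not_le.mp hφ).le 2).trans (hd k hk)))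

variable {n l m : ℕ} {D : Data n l m} {Ω : Type*} [MeasurableSpace Ω] {Pr : Measure Ω}
  {W : ℕ → Ω → Vec m} {Xs : ℕ → Ω → Vec n} {Us : ℕ → Ω → Vec l} {lam : ℕ → (Ω → Vec n) → ℝ}
  {X₀ : Ω → Vec n} {N : ℕ} {U : ℕ → Ω → Vec l} {α β : ℝ → ℝ}

theorem Data.IsStrictlyDissipative.mono (hdiss : D.IsStrictlyDissipative Pr W Xs Us lam β)
    (hα : IsClassKInfty α) (hαβ : ∀ t, 0 ≤ t → α t ≤ β t) :
    D.IsStrictlyDissipative Pr W Xs Us lam α where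
  bddBelow := hdiss.bddBelow
  kInfty := hα
  ineq k X U hX hU hXW hUW :=
    (hαβ _ (integral_nonneg fun _ => sq_nonneg _)).trans (hdiss.ineq k X U hX hU hXW hUW)

variable [IsProbabilityMeasure Pr]

theorem Data.IsAdmissible.memLp_traj (hU : D.IsAdmissible Pr W X₀ N U)
    (hW2 : ∀ k, MemLp (W k) 2 Pr) (hX₀ : MemLp X₀ 2 Pr) {k : ℕ} (hk : k ≤ N) :
    MemLp (D.traj W X₀ U k) 2 Pr := by
  induction k with
  | zero => exact hX₀
  | succ k ih => exact D.memLp_f (ih (by omega)) (hU.memLp k (by omega)) (hW2 k)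

theorem Data.IsStrictlyDissipative.sum_le (hdiss : D.IsStrictlyDissipative Pr W Xs Us lam β)
    (hW2 : ∀ k, MemLp (W k) 2 Pr) (hX₀ : MemLp X₀ 2 Pr) (hU : D.IsAdmissible Pr W X₀ N U) :
    ∑ k ∈ Finset.range N, β (∫ ω, ‖D.traj W X₀ U k ω - Xs k ω‖ ^ 2 ∂Pr)
      ≤ D.totalCost Pr W X₀ N U - ∑ k ∈ Finset.range N, D.cost Pr (Xs k) (Us k)
        + (lam 0 X₀ - lam N (D.traj W X₀ U N)) := by
  have hstep : ∀ k ∈ Finset.range N, β (∫ ω, ‖D.traj W X₀ U k ω - Xs k ω‖ ^ 2 ∂Pr)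
      ≤ D.cost Pr (D.traj W X₀ U k) (U k) - D.cost Pr (Xs k) (Us k)
        + (lam k (D.traj W X₀ U k) - lam (k + 1) (D.traj W X₀ U (k + 1))) := fun k hk => by
    rw [Finset.mem_range] at hk
    rw [← add_sub_assoc]
    exact hdiss.ineq k _ _ (hU.memLp_traj hW2 hX₀ hk.le) (hU.memLp k hk) (hU.indep_state k hk)
      (hU.indep_control k hk)
  refine (Finset.sum_le_sum hstep).trans_eq ?_
  rw [Finset.sum_add_distrib, Finset.sum_sub_distrib,
    Finset.sum_range_sub' fun k => lam k (D.traj W X₀ U k)]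
  rfl

theorem Data.IsStrictlyDissipative.momentTurnpike
    (hdiss : D.IsStrictlyDissipative Pr W Xs Us lam β) (hW2 : ∀ k, MemLp (W k) 2 Pr)
    (hXs : ∀ k, MemLp (Xs k) 2 Pr) {a₁ a₂ : ℝ → ℝ}
    (h₁ : ∀ ε, 0 < ε → 0 < a₁ ε ∧ a₁ ε ≤ β (ε ^ 2))
    (h₂ : ∀ ε, 0 < ε → 0 < a₂ ε ∧ a₂ ε ≤ β (ε ^ 2)) :
    D.MomentTurnpike Pr W Xs Us a₁ a₂ := by
  intro X₀ _ hX₀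
  obtain ⟨b, hb⟩ := hdiss.bddBelow
  refine ⟨lam 0 X₀ - b, fun N δ _ U hU hcost ε hε => ?_⟩
  have htraj : ∀ k ≤ N, MemLp (D.traj W X₀ U k) 2 Pr := fun k => hU.memLp_traj hW2 hX₀
  have hsum : ∑ k ∈ Finset.range N, β (∫ ω, ‖D.traj W X₀ U k ω - Xs k ω‖ ^ 2 ∂Pr)
      ≤ δ + (lam 0 X₀ - b) := by
    linarith [hdiss.sum_le hW2 hX₀ hU, hb N _ (htraj N le_rfl)]
  exact ⟨hdiss.kInfty.sub_div_le_ncard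
      (fun k hk => norm_integral_sub_integral_sq_le (htraj k hk.le) (hXs k)) hsum hε.le
      (h₁ ε hε).1 (h₁ ε hε).2,
    hdiss.kInfty.sub_div_le_ncard
      (fun k hk => sq_abs_sqrt_trace_covMat_sub_le (htraj k hk.le) (hXs k)) hsum hε.le
      (h₂ ε hε).1 (h₂ ε hε).2⟩

theorem Data.IsStrictlyDissipative.momentTurnpike_sq
    (hdiss : D.IsStrictlyDissipative Pr W Xs Us lam β) (hW2 : ∀ k, MemLp (W k) 2 Pr)
    (hXs : ∀ k, MemLp (Xs k) 2 Pr) :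
    D.MomentTurnpike Pr W Xs Us (fun ε => β (ε ^ 2)) fun ε => β (ε ^ 2) :=
  have hβ : ∀ ε, 0 < ε → 0 < β (ε ^ 2) ∧ β (ε ^ 2) ≤ β (ε ^ 2) := fun _ hε =>
    ⟨hdiss.kInfty.pos (sq_pos_of_pos hε), le_rfl⟩
  hdiss.momentTurnpike hW2 hXs hβ hβ

end Turnpike

section ComparisonFunction

variable {c : ℝ}

theorem isClassKInfty_const_mul (hc : 0 < c) : IsClassKInfty fun t => c * t where
  continuousOn := by fun_prop
  strictMonoOn := fun _ _ _ _ h => mul_lt_mul_of_pos_left h hc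
  map_zero := mul_zero c
  unbounded b := ⟨|b| / c, by positivity, by
    rw [mul_div_cancel₀ _ hc.ne']; exact le_abs_self b⟩

/-- The comparison function of the stationary process. Dissipativity holds with `c * t`; the quartic
branch makes the value at `√(2 * ε)`, hence also at `√ε`, at most `c * ε ^ 2`, as the moment
estimates require. -/
noncomputable def turnpikeRate (c t : ℝ) : ℝ := c * min t (t ^ 4 / 4)

theorem turnpikeRate_le (hc : 0 ≤ c) (t : ℝ) : turnpikeRate c t ≤ c * t :=
  mul_le_mul_of_nonneg_left (min_le_left _ _) hc

theorem turnpikeRate_eq_of_two_le {t : ℝ} (ht : 2 ≤ t) : turnpikeRate c t = c * t := by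
  have hcube : 2 ^ 3 ≤ t ^ 3 := by gcongr
  rw [turnpikeRate, min_eq_left]
  nlinarith

theorem isClassKInfty_turnpikeRate (hc : 0 < c) : IsClassKInfty (turnpikeRate c) where
  continuousOn := by unfold turnpikeRate; fun_prop
  strictMonoOn := fun s hs t _ hst => by
    have hs' : 0 ≤ s := hs
    have hpow : s ^ 4 / 4 < t ^ 4 / 4 := by gcongr
    exact mul_lt_mul_of_pos_left (min_lt_min hst hpow) hc
  map_zero := by simp [turnpikeRate]
  unbounded b := by
    refine ⟨max 2 (|b| / c), by positivity, ?_⟩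
    rw [turnpikeRate_eq_of_two_le (le_max_left _ _), mul_comm]
    exact (le_abs_self b).trans ((div_le_iff₀ hc).mp (le_max_right _ _))

theorem turnpikeRate_sqrt_le (hc : 0 ≤ c) {s ε : ℝ} (hε : 0 ≤ ε) (hsε : s ≤ 2 * ε) :
    turnpikeRate c √s ≤ c * ε ^ 2 := by
  refine mul_le_mul_of_nonneg_left ((min_le_right _ _).trans ?_) hc
  calc √s ^ 4 / 4 ≤ √(2 * ε) ^ 4 / 4 := by gcongr
    _ = ε ^ 2 := by
      rw [show 4 = 2 * 2 from rfl, pow_mul, Real.sq_sqrt (by positivity)]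
      ring

end ComparisonFunction

section ClosedLoop

variable {n l m : ℕ} {D : Data n l m} {P S : Matrix (Fin n) (Fin n) ℝ} {x xs q : Vec n}
  {u us : Vec l} {μ : Vec m}

theorem Data.IsSteadyState.sub (hx : D.IsSteadyState μ x u) (hxs : D.IsSteadyState μ xs us) :
    (x - xs) - mv D.A (x - xs) - mv D.B (u - us) = 0 := by
  rw [mv_sub, mv_sub, ← sub_eq_zero.mpr (hx.trans hxs.symm)]
  abel

theorem feedback_sub_sub (P : Matrix (Fin n) (Fin n) ℝ) (xs x : Vec n) (us u : Vec l)
    (y : Vec n) : D.feedback P xs (x - xs) us (u - us) y = mv (D.gain P) (y - x) + u := by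
  rw [Data.feedback, sub_sub, sub_add_cancel, add_assoc, sub_add_cancel]

/-- The closed-loop dynamics under the feedback with gain `D.gain P` centred at `(x, u)`, as a map
of the pair of state and noise. -/
noncomputable def Data.closedLoopMap (D : Data n l m) (P : Matrix (Fin n) (Fin n) ℝ) (x : Vec n)
    (u : Vec l) (p : Vec n × Vec m) : Vec n :=
  D.f p.1 (mv (D.gain P) (p.1 - x) + u) p.2

theorem measurable_closedLoopMap (P : Matrix (Fin n) (Fin n) ℝ) (x : Vec n) (u : Vec l) :
    Measurable (D.closedLoopMap P x u) := by
  unfold Data.closedLoopMap Data.f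
  fun_prop

theorem Data.IsSteadyState.closedLoopMap_sub (hx : D.IsSteadyState μ x u)
    (P : Matrix (Fin n) (Fin n) ℝ) (p : Vec n × Vec m) :
    D.closedLoopMap P x u p - x = mv (D.closedLoop P) (p.1 - x) + mv D.E (p.2 - μ) := by
  rw [Data.closedLoopMap, hx.f_sub, add_sub_cancel_right, closedLoop_mv]

theorem Data.IsSteadyState.exists_invariant_measure (hx : D.IsSteadyState μ x u)
    (hstab : IsExponentiallyStable (D.closedLoop P)) {ν : Measure (Vec m)}
    [IsProbabilityMeasure ν] {p : ENNReal} [Fact (1 ≤ p)] (hν : MemLp id p ν) :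
    ∃ ρ : Measure (Vec n), IsProbabilityMeasure ρ ∧ MemLp id p ρ ∧
      HasLaw (D.closedLoopMap P x u) ρ (ρ.prod ν) := by
  have hmap : D.closedLoopMap P x u = fun p => mv (D.closedLoop P) p.1
      + (mv D.E (p.2 - μ) + (x - mv (D.closedLoop P) x)) := funext fun p => by
    rw [← sub_add_cancel (D.closedLoopMap P x u p) x, hx.closedLoopMap_sub, mv_sub]
    abel
  rw [hmap]
  exact exists_invariant_measure_comp hstab (by fun_prop)
    ((memLp_mv D.E (hν.sub (memLp_const μ))).add (memLp_const _))

variable {Ω : Type*} [MeasurableSpace Ω] {Pr : Measure Ω} {W : ℕ → Ω → Vec m}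
  {ρ : Measure (Vec n)} {Xs : ℕ → Ω → Vec n} {Us : ℕ → Ω → Vec l}

/-- The closed-loop process under the feedback centred at `(x, u)`, all of whose states have the
square-integrable law `ρ` and are independent of the current noise. -/
structure Data.IsStationaryClosedLoop (D : Data n l m) (Pr : Measure Ω) (W : ℕ → Ω → Vec m)
    (P : Matrix (Fin n) (Fin n) ℝ) (x : Vec n) (u : Vec l) (ρ : Measure (Vec n))
    (Xs : ℕ → Ω → Vec n) (Us : ℕ → Ω → Vec l) : Prop where
  control : ∀ k ω, Us k ω = mv (D.gain P) (Xs k ω - x) + u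
  state : ∀ k ω, Xs (k + 1) ω = D.f (Xs k ω) (Us k ω) (W k ω)
  memLp_law : MemLp id 2 ρ
  hasLaw : ∀ k, HasLaw (Xs k) ρ Pr
  indepFun : ∀ k, IndepFun (Xs k) (W k) Pr

theorem isStationaryClosedLoop_of_invariant [IsFiniteMeasure Pr] (hWm : ∀ k, Measurable (W k))
    (hWind : iIndepFun W Pr) (hWid : ∀ k, IdentDistrib (W k) (W 0) Pr Pr) (hρ2 : MemLp id 2 ρ)
    (hρ : HasLaw (D.closedLoopMap P x u) ρ (ρ.prod (Pr.map (W 0)))) (hX₀ : Measurable (Xs 0))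
    (hlaw : HasLaw (Xs 0) ρ Pr) (hX₀W : IndepFun (Xs 0) (fun ω k => W k ω) Pr)
    (hUs : ∀ k ω, Us k ω = mv (D.gain P) (Xs k ω - x) + u)
    (hXs : ∀ k ω, Xs (k + 1) ω = D.f (Xs k ω) (Us k ω) (W k ω)) :
    D.IsStationaryClosedLoop Pr W P x u ρ Xs Us := by
  have hrec : ∀ k ω, Xs (k + 1) ω = D.closedLoopMap P x u (Xs k ω, W k ω) := fun k ω => by
    rw [hXs, hUs, Data.closedLoopMap]
  have hindep := indepFun_of_recursion hWm hWind (measurable_closedLoopMap P x u) hX₀ hX₀W hrec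
  have hnoise : ∀ k, HasLaw (W k) (Pr.map (W 0)) Pr := fun k =>
    ⟨(hWm k).aemeasurable, (hWid k).map_eq⟩
  exact ⟨hUs, hXs, hρ2, hasLaw_of_recursion hnoise hindep hrec hρ hlaw, hindep⟩

namespace Data.IsStationaryClosedLoop

variable (hcl : D.IsStationaryClosedLoop Pr W P x u ρ Xs Us)

include hcl

theorem memLp (k : ℕ) : MemLp (Xs k) 2 Pr := memLp_of_hasLaw (hcl.hasLaw k) hcl.memLp_law

theorem integral_comp_eq {𝓔 : Type*} [NormedAddCommGroup 𝓔] [NormedSpace ℝ 𝓔]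
    [MeasurableSpace 𝓔] [BorelSpace 𝓔] {φ : Vec n → 𝓔} (hφ : Measurable φ) (j k : ℕ) :
    ∫ ω, φ (Xs j ω) ∂Pr = ∫ ω, φ (Xs k ω) ∂Pr :=
  (((hcl.hasLaw j).identDistrib (hcl.hasLaw k)).comp hφ).integral_eq

variable [IsProbabilityMeasure Pr]

theorem isStationaryPair : D.IsStationaryPair Pr W Xs Us := by
  have hfb : Measurable fun y : Vec n => mv (D.gain P) (y - x) + u := by fun_prop
  have hUs : ∀ k, Us k = fun ω => mv (D.gain P) (Xs k ω - x) + u := fun k =>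
    funext (hcl.control k)
  have hρ : IsProbabilityMeasure ρ := (hcl.hasLaw 0).isProbabilityMeasure_iff.mp ‹_›
  have hlaw : HasLaw (fun y : Vec n => mv (D.gain P) (y - x) + u) _ ρ := ⟨hfb.aemeasurable, rfl⟩
  have hfbρ : MemLp (fun y : Vec n => mv (D.gain P) (y - x) + u) 2 ρ :=
    (memLp_mv _ (hcl.memLp_law.sub (memLp_const x))).add (memLp_const u)
  exact {
    law_state := ⟨ρ, hρ, hcl.memLp_law, hcl.hasLaw⟩
    law_control := ⟨ρ.map fun y => mv (D.gain P) (y - x) + u,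
      Measure.isProbabilityMeasure_map hfb.aemeasurable,
      (memLp_map_measure_iff (by fun_prop) hfb.aemeasurable).mpr hfbρ,
      fun k => hUs k ▸ hlaw.fun_comp (hcl.hasLaw k)⟩
    dynamics := fun k => .of_forall (hcl.state k)
    indep_state := hcl.indepFun
    indep_control := fun k => hUs k ▸ (hcl.indepFun k).comp hfb measurable_id }

/-- The deviation of the mean from `x` is a fixed point of the stable closed-loop matrix. -/
theorem integral_eq (hW2 : MemLp (W 0) 2 Pr) (hx : D.IsSteadyState (∫ ω, W 0 ω ∂Pr) x u)
    (hstab : IsExponentiallyStable (D.closedLoop P)) (k : ℕ) : ∫ ω, Xs k ω ∂Pr = x := by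
  have hZ : MemLp (fun ω => Xs 0 ω - x) 2 Pr := (hcl.memLp 0).sub (memLp_const x)
  have hWc : MemLp (fun ω => W 0 ω - ∫ ω', W 0 ω' ∂Pr) 2 Pr := hW2.sub (memLp_const _)
  have hstep : ∀ ω, Xs 1 ω - x = mv (D.closedLoop P) (Xs 0 ω - x)
      + mv D.E (W 0 ω - ∫ ω', W 0 ω' ∂Pr) := fun ω => by
    rw [hcl.state 0, hcl.control]
    exact hx.closedLoopMap_sub P (Xs 0 ω, W 0 ω)
  have hfixed : mv (D.closedLoop P) (∫ ω, (Xs 0 ω - x) ∂Pr) = ∫ ω, (Xs 0 ω - x) ∂Pr := calc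
    _ = ∫ ω, (Xs 1 ω - x) ∂Pr := by
      rw [integral_congr_ae (.of_forall hstep),
        integral_mv_add_mv _ _ (hZ.integrable one_le_two) (hWc.integrable one_le_two),
        integral_sub_integral (hW2.integrable one_le_two), mv_zero, add_zero]
    _ = ∫ ω, (Xs 0 ω - x) ∂Pr := hcl.integral_comp_eq (measurable_sub_const' x) 1 0
  have hzero := hstab.eq_zero_of_mv_eq hfixed
  rw [integral_sub ((hcl.memLp 0).integrable one_le_two) (integrable_const x), integral_const,
    probReal_univ, one_smul, sub_eq_zero] at hzero
  exact (hcl.integral_comp_eq measurable_id k 0).trans hzero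

theorem bddBelow_storage (hP : P.IsHermitian) (hS : S.PosDef) (q xs : Vec n) :
    ∃ M : ℝ, ∀ k X, MemLp X 2 Pr →
      M ≤ storage Pr P S (q - (2 : ℝ) • mv S (x - xs)) xs (x - xs) Xs k X := by
  obtain ⟨r, hr, hSr⟩ := exists_mul_norm_sq_le_qf hS
  refine ⟨∫ ω, -(‖q - (2 : ℝ) • mv P (Xs 0 ω - x)‖ ^ 2 / (4 * r)) ∂Pr
    + ∫ ω, storageOffset P S q x (x - xs) (Xs 0 ω) ∂Pr, fun k X hX => ?_⟩
  rw [storage_eq_deviationStorage_add hP hS.isHermitian q x xs hX (hcl.memLp k),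
    hcl.integral_comp_eq (measurable_storageOffset P S q x (x - xs)) k 0,
    hcl.integral_comp_eq (φ := fun y => -(‖q - (2 : ℝ) • mv P (y - x)‖ ^ 2 / (4 * r)))
      (by fun_prop) 0 k]
  gcongr
  exact le_deviationStorage hr hSr P q x hX (hcl.memLp k)

theorem isStrictlyDissipative {c : ℝ} (hQ₁ : D.Q₁.PosSemidef) (hQ₂ : D.Q₂.PosSemidef)
    (hR₁ : D.R₁.PosDef) (hR₂ : D.R₂.PosSemidef) (hP : D.IsRiccatiSolution P)
    (hS : D.IsStorageMatrix S c) (hW2 : ∀ k, MemLp (W k) 2 Pr)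
    (hWid : ∀ k, IdentDistrib (W k) (W 0) Pr Pr)
    (hx : D.IsSteadyState (∫ ω, W 0 ω ∂Pr) x u) (hq : D.IsKKTPoint x u q) (xs : Vec n) :
    D.IsStrictlyDissipative Pr W Xs Us
      (storage Pr P S (q - (2 : ℝ) • mv S (x - xs)) xs (x - xs) Xs) fun t => c * t where
  bddBelow := hcl.bddBelow_storage hP.1.isHermitian hS.posDef q xs
  kInfty := isClassKInfty_const_mul hS.rate_pos
  ineq k X U hX hU hXW hUW := by
    have hPH := hP.1.isHermitian
    have hSH := hS.posDef.isHermitian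
    have hstab := isExponentiallyStable_closedLoop hQ₂ hR₂ (hR₁.add_posSemidef hR₂) hP hS
    have hstep := hS.mul_integral_norm_sub_sq_le hQ₁ hQ₂ hR₁ hR₂ hP
      ((hWid k).integral_eq ▸ hx) hq hX hU (hcl.memLp k) (hW2 k) hXW hUW (hcl.indepFun k)
      (hcl.integral_eq (hW2 0) hx hstab k) (hcl.control k)
    rw [storage_eq_deviationStorage_add hPH hSH q x xs hX (hcl.memLp k),
      storage_eq_deviationStorage_add hPH hSH q x xs (D.memLp_f hX hU (hW2 k))
        (hcl.memLp (k + 1)),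
      hcl.integral_comp_eq (measurable_storageOffset P S q x (x - xs)) (k + 1) k,
      funext (hcl.state k)]
    linarith

end Data.IsStationaryClosedLoop

end ClosedLoop

end StochLQ

theorem mainTheorem5 {n l m : ℕ} (D : Data n l m)
    (hAB : IsStabilizable D.A D.B)
    (hQ₁ : D.Q₁.PosSemidef) (hQ₂ : D.Q₂.PosSemidef)
    (hR₁ : D.R₁.PosDef) (hR₂ : D.R₂.PosSemidef)
    {Ω : Type*} [MeasurableSpace Ω] (Pr : Measure Ω) [IsProbabilityMeasure Pr]
    (W : ℕ → Ω → Vec m) (hWm : ∀ k, Measurable (W k)) (hW2 : ∀ k, MemLp (W k) 2 Pr)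
    (hWind : iIndepFun W Pr) (hWid : ∀ k, IdentDistrib (W k) (W 0) Pr Pr)
    (xs : Vec n) (us : Vec l)
    (hss : xs - mv D.A xs - mv D.B us = mv D.E (∫ ω, W 0 ω ∂Pr) + D.z)
    (hdet : IsDetectable D.A (CFC.sqrt D.Q₁)) :
    ∃ (P S : Matrix (Fin n) (Fin n) ℝ) (q xt : Vec n) (ut : Vec l) (ρ : Measure (Vec n))
      (α : ℝ → ℝ),
      D.IsRiccatiSolution P ∧ S.PosDef ∧ xt - mv D.A xt - mv D.B ut = 0 ∧
      -- `ρ` is an invariant distribution of the closed loop with finite second moment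
      IsProbabilityMeasure ρ ∧ MemLp id 2 ρ ∧
      (ρ.prod (Pr.map (W 0))).map
        (fun p => D.f p.1 (D.feedback P xs xt us ut p.1) p.2) = ρ ∧
      -- an initial condition with law `ρ`, independent of the noise, exists as soon as the
      -- probability space carries a uniform random variable independent of the noise
      ((∃ ξ : Ω → unitInterval, Measurable ξ ∧ HasLaw ξ volume Pr ∧
          IndepFun ξ (fun ω k => W k ω) Pr) →
        ∃ Xs₀ : Ω → Vec n, Measurable Xs₀ ∧ HasLaw Xs₀ ρ Pr ∧
          IndepFun Xs₀ (fun ω k => W k ω) Pr) ∧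
      -- any closed-loop process started in such an initial condition has the claimed properties
      ∀ (Xs : ℕ → Ω → Vec n) (Us : ℕ → Ω → Vec l),
        Measurable (Xs 0) → HasLaw (Xs 0) ρ Pr → IndepFun (Xs 0) (fun ω k => W k ω) Pr →
        (∀ k ω, Us k ω = D.feedback P xs xt us ut (Xs k ω)) →
        (∀ k ω, Xs (k + 1) ω = D.f (Xs k ω) (Us k ω) (W k ω)) →
        D.IsStationaryPair Pr W Xs Us ∧
        D.IsStrictlyDissipative Pr W Xs Us (storage Pr P S q xs xt Xs) α ∧
        D.MomentTurnpike Pr W Xs Us (fun ε => α √ε) (fun ε => α √(2 * ε)) ∧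
        -- for an arbitrary comparison function of the dissipativity inequality
        ∀ (lam : ℕ → (Ω → Vec n) → ℝ) (β : ℝ → ℝ),
          D.IsStrictlyDissipative Pr W Xs Us lam β →
          D.MomentTurnpike Pr W Xs Us (fun ε => β (ε ^ 2)) (fun ε => β (ε ^ 2)) := by
  obtain ⟨S, c, hS⟩ := exists_isStorageMatrix hQ₁ hR₁ hdet
  have hR := hR₁.add_posSemidef hR₂
  obtain ⟨P, hP⟩ := exists_isRiccatiSolution hAB (hQ₁.add hQ₂) hR
  have hstab := isExponentiallyStable_closedLoop hQ₂ hR₂ hR hP hS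
  obtain ⟨x, u, q, hx, hq⟩ := exists_isKKTPoint hQ₁ hR₁ hS hss
  have hν := Measure.isProbabilityMeasure_map (μ := Pr) (hWm 0).aemeasurable
  have hν2 : MemLp id 2 (Pr.map (W 0)) :=
    (memLp_map_measure_iff (by fun_prop) (by fun_prop)).mpr (hW2 0)
  obtain ⟨ρ, hρ, hρ2, hinv⟩ := hx.exists_invariant_measure hstab hν2
  have hα := isClassKInfty_turnpikeRate hS.rate_pos
  refine ⟨P, S, q - (2 : ℝ) • mv S (x - xs), x - xs, u - us, ρ, turnpikeRate c, hP, hS.posDef,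
    hx.sub hss, hρ, hρ2, ?_,
    fun ⟨ξ, hξ, hlaw, hind⟩ => exists_hasLaw_of_uniform ρ hξ hlaw hind, ?_⟩
  all_goals simp only [feedback_sub_sub]
  · exact hinv.map_eq
  intro Xs Us hX₀ hlaw hind hUs hXs
  have hcl := isStationaryClosedLoop_of_invariant hWm hWind hWid hρ2 hinv hX₀ hlaw hind hUs hXs
  have hdiss := hcl.isStrictlyDissipative hQ₁ hQ₂ hR₁ hR₂ hP hS hW2 hWid hx hq xs
  exact ⟨hcl.isStationaryPair, hdiss.mono hα fun t _ => turnpikeRate_le hS.rate_pos.le t,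
    hdiss.momentTurnpike hW2 hcl.memLp
      (fun ε hε => ⟨hα.pos (by positivity), turnpikeRate_sqrt_le hS.rate_pos.le hε.le
        (by linarith)⟩)
      fun ε hε => ⟨hα.pos (by positivity), turnpikeRate_sqrt_le hS.rate_pos.le hε.le le_rfl⟩,
    fun lam β hβ => hβ.momentTurnpike_sq hW2 hcl.memLp⟩
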